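/- Let $\mathsf N=\begin{pmatrix}0&1&0&0\\0&0&0&0\\0&0&0&1\\0&0&0&0\end{pmatrix}$ be the nilpotent matrix on $\mathbb R^4$ with two $2\times2$ Jordan blocks, let $\mathsf M=\mathsf N^{t}$, and for $k\ge 0$ let $\mathcal P_k$ be the space of polynomial maps $\mathbb R^4\to\mathbb R^4$ that are homogeneous of degree $k+1$. Put $(\Delta_{\mathsf N}\varphi)(x)=\mathsf N\varphi(x)-\varphi(\mathsf Nx)$. For a ring and elements $n,m$ put $\bar m=\sum_{i=1}^{p-1}\sum_{l=0}^{i-1}n^lm^in^{i-l-1}$ and $\bar h=\sum_{i=1}^{p-1}[m^i,n^i]$, where $p$ is the nilpotency index of $\mathsf N$ (here $p=2$, so $\bar m=m$ and $\bar h=[m,n]$). Let $\Delta_{\bar{\mathsf M}}=\bar{\mathsf M}_*-\overline{\mathsf M^*}$ and $\bar{\mathsf H}_*+\overline{\mathsf H^*}$ be the operators on polynomial maps obtained by applying these formulas to the multiplication operators $\varphi\mapsto\mathsf N\varphi(x),\ \mathsf M\varphi(x)$ and to the substitution operators $\varphi\mapsto\varphi(\mathsf Nx),\ \varphi(\mathsf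 Mx)$, respectively; thus here $(\Delta_{\bar{\mathsf M}}\varphi)(x)=\mathsf M\varphi(x)-\varphi(\mathsf Mx)$. A formal map $f=\mathsf Nx+\sum_{k\ge1}f_k$ with $f_k\in\mathcal P_k$ is in normal form (in $\ker\Delta_{\bar{\mathsf M}}$-style) if $f_k\in\ker\Delta_{\bar{\mathsf M}}$ for all $k\ge1$. Then: 1. $\mathcal P_k=\Delta_{\mathsf N}(\mathcal P_k)\oplus(\mathcal P_k\cap\ker\Delta_{\bar{\mathsf M}})$ for every $k\ge0$. 2. The polynomial maps without constant term in $\ker\Delta_{\bar{\mathsf M}}$ are exactly the maps $$ \begin{pmatrix} x_1F_1^1(x_1,x_3)+x_3F_3^1(x_3)\\ L_F(x)\\ x_1G_1^1(x_1,x_3)+x_3G_3^1(x_3)\\ L_G(x) \end{pmatrix}, $$ $$ \begin{aligned} L_F={}&x_1x_2F_{1,2}^0(x_1,x_2,x_3,x_4)+x_1x_4F_{1,4}^0(x_1,x_3,x_4)+x_2x_3F_{2,3}^0(x_2,x_3,x_4)+x_3x_4F_{3,4}^0(x_3,x_4)\\ &+x_1F_1^0(x_1,x_3)+x_2F_1^1(x_2,x_4)+x_3F_3^0(x_3)+x_4F_3^1(x_4),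 \end{aligned} $$ where $L_G$ is given by the same formula with $G$ in place of $F$, and the $F$'s and $G$'s are arbitrary polynomials; these polynomials are uniquely determined by the map. 3. A formal map $f$ is in normal form with linear part $\mathsf N$ if and only if $f(x)=\mathsf Nx$ plus a map of the form in 2, in which the $F$'s and $G$'s are formal power series and $F_1^0,F_1^1,F_3^0,F_3^1,G_1^0,G_1^1,G_3^0,G_3^1$ have zero constant term; these series are then unique. For every formal map $f$ with $f(0)=0$ and $Df(0)=\mathsf N$ there is a formal near-identity transformation $\varphi$ (that is, $\varphi(0)=0$ and $D\varphi(0)=I$) such that $\varphi\circ f\circ\varphi^{-1}$ is in normal form. 4. Let $m(d,w)$ be the multiplicity of the eigenvalue $w$ of $\bar{\mathsf H}_*+\overline{\mathsf H^*}$ on the kernel of $\Delta_{\bar{\mathsf M}}$ in $\mathcal P_{d-1}$, and let $G(u,t)=2u+\sum_{d\ge1}\sum_{w\ge0}m(d,w)u^wt^d$, where the conventional term $2u$ accounts for the constant maps $e_2,e_4$ (which span $\ker\mathsf M$ and have $\mathsf H$-eigenvalue $1$). Then $$G(u,t)=2u+\frac{2ut^2}{(1-t)^4}+2\frac{2ut^2}{(1-t)^3}+\frac{2ut^2}{(1-t)^2}+2\frac{(u^2+1)t}{(1-t)^2}+2\frac{(u^2+1)t}{1-t}.$$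 It passes the Cushman–Sanders test: $\frac{\partial}{\partial u}\bigl(uG(u,t)\bigr)\big|_{u=1}=\frac{4}{(1-t)^4}$, which is the generating function $\sum_{d\ge0}t^d\dim\{\text{polynomial maps }\mathbb R^4\to\mathbb R^4\text{ homogeneous of degree }d\}$. The generating function of the kernel is $$G(1,t)=2+\sum_{d\ge1}\dim\bigl(\mathcal P_{d-1}\cap\ker\Delta_{\bar{\mathsf M}}\bigr)t^d=\frac{2}{(1-t)^4}.$$ -/

import Mathlib

namespace NilpotentMaps

noncomputable section

/-! ### Polynomial maps and the operators acting on them -/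

/-- Polynomial maps from `ℝⁿ` to `ℝⁿ`, i.e. `ℝ[x₁, …, xₙ] ⊗ ℝⁿ`, written in components. -/
abbrev PolyMap (n : ℕ) : Type := Fin n → MvPolynomial (Fin n) ℝ

/-- The polynomial maps all of whose components are homogeneous of degree `d`. -/
def homogeneousMaps (n d : ℕ) : Submodule ℝ (PolyMap n) :=
  Submodule.pi Set.univ fun _ => MvPolynomial.homogeneousSubmodule (Fin n) ℝ d

/-- The multiplication operator `(A_* φ)(x) = A φ(x)`. -/
def multOp {n : ℕ} (A : Matrix (Fin n) (Fin n) ℝ) : Module.End ℝ (PolyMap n) :=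
  LinearMap.pi fun i => ∑ j, A i j • LinearMap.proj j

/-- The substitution operator `(A^* φ)(x) = φ(A x)`. -/
def substOp {n : ℕ} (A : Matrix (Fin n) (Fin n) ℝ) : Module.End ℝ (PolyMap n) :=
  LinearMap.compLeft
    (MvPolynomial.aeval (R := ℝ)
      fun j : Fin n => ∑ l, A j l • (MvPolynomial.X l : MvPolynomial (Fin n) ℝ)).toLinearMap
    (Fin n)

/-- The homological operator `φ ↦ A φ(x) - φ(A x)`. -/
def homologicalOp {n : ℕ} (A : Matrix (Fin n) (Fin n) ℝ) : Module.End ℝ (PolyMap n) :=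
  multOp A - substOp A

/-- The element `m̄ = ∑_{i=1}^{p-1} ∑_{l=0}^{i-1} n^l m^i n^{i-l-1}`. -/
def barM {R : Type*} [Ring R] (p : ℕ) (n m : R) : R :=
  ∑ i ∈ Finset.Icc 1 (p - 1), ∑ l ∈ Finset.range i, n ^ l * m ^ i * n ^ (i - l - 1)

/-- The element `h̄ = ∑_{i=1}^{p-1} [m^i, n^i]`. -/
def barH {R : Type*} [Ring R] (p : ℕ) (n m : R) : R :=
  ∑ i ∈ Finset.Icc 1 (p - 1), (m ^ i * n ^ i - n ^ i * m ^ i)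

/-- The operator `Δ_{M̄} = M̄_* - \overline{M^*}` attached to a nilpotent matrix `N` in Jordan form,
where `M` is the transpose of `N` and the index `p` in the bars is the nilpotency index of `N`. -/
def deltaBarM {n : ℕ} (N : Matrix (Fin n) (Fin n) ℝ) : Module.End ℝ (PolyMap n) :=
  multOp (barM (nilpotencyClass N) N N.transpose)
    - barM (nilpotencyClass N) (substOp N) (substOp N.transpose)

/-- The operator `H̄_* + \overline{H^*}`, the semisimple element of the `sl₂`-triple to which
`homologicalOp N` and `deltaBarM N` belong. -/
def sumBarH {n : ℕ} (N : Matrix (Fin n) (Fin n) ℝ) : Module.End ℝ (PolyMap n) :=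
  multOp (barH (nilpotencyClass N) N N.transpose)
    + barH (nilpotencyClass N) (substOp N) (substOp N.transpose)

/-! ### Normal form styles -/

/-- `C` is a normal form style for `A`: for every `k`, the space of homogeneous maps of degree
`k + 1` is the direct sum of the image of the homological operator and `C k`. -/
def IsStyle {n : ℕ} (A : Matrix (Fin n) (Fin n) ℝ) (C : ℕ → Submodule ℝ (PolyMap n)) : Prop :=
  ∀ k : ℕ, Disjoint ((homogeneousMaps n (k + 1)).map (homologicalOp A)) (C k) ∧
    (homogeneousMaps n (k + 1)).map (homologicalOp A) ⊔ C k = homogeneousMaps n (k + 1)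

/-- The `ker Δ_{M̄}`-style: the kernel of `Δ_{M̄}` on homogeneous maps of degree `k + 1`. -/
def kerStyle {n : ℕ} (N : Matrix (Fin n) (Fin n) ℝ) (k : ℕ) : Submodule ℝ (PolyMap n) :=
  homogeneousMaps n (k + 1) ⊓ LinearMap.ker (deltaBarM N)

/-! ### Formal maps -/

/-- `n`-tuples of formal power series in `n` variables (Taylor expansions at the origin). -/
abbrev FormalMap (n : ℕ) : Type := Fin n → MvPowerSeries (Fin n) ℝ

/-- The formal map fixes the origin. -/
def FixesZero {n : ℕ} (f : FormalMap n) : Prop :=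
  ∀ i, MvPowerSeries.constantCoeff (f i) = 0

/-- The derivative at the origin. -/
def jacobianAtZero {n : ℕ} (f : FormalMap n) : Matrix (Fin n) (Fin n) ℝ :=
  Matrix.of fun i j => MvPowerSeries.coeff (Finsupp.single j 1) (f i)

/-- The identity map. -/
def idMap (n : ℕ) : FormalMap n := fun i => MvPowerSeries.X i

/-- The linear map `x ↦ A x`. -/
def linearMap {n : ℕ} (A : Matrix (Fin n) (Fin n) ℝ) : FormalMap n :=
  fun i => ∑ j, A i j • MvPowerSeries.X j

/-- Composition `f ∘ g` of formal maps (used only if `g` fixes the origin). -/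
def comp {n : ℕ} (f g : FormalMap n) : FormalMap n :=
  fun i => MvPowerSeries.subst g (f i)

/-- Near identity transformations. -/
def NearIdentity {n : ℕ} (φ : FormalMap n) : Prop :=
  FixesZero φ ∧ jacobianAtZero φ = 1

/-- The part of degree `d` of a formal map. -/
def homogeneousPart {n : ℕ} (d : ℕ) (f : FormalMap n) : PolyMap n :=
  fun i => MvPolynomial.homogeneousComponent d (MvPowerSeries.truncTotal (d + 1) (f i))

/-- The formal map `f` fixes the origin, has linear part `A`, and its nonlinear terms `f_k`
(of degree `k + 1`, `k ≥ 1`) lie in `C k`. -/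
def IsInNormalForm {n : ℕ} (A : Matrix (Fin n) (Fin n) ℝ) (C : ℕ → Submodule ℝ (PolyMap n))
    (f : FormalMap n) : Prop :=
  FixesZero f ∧ jacobianAtZero f = A ∧ ∀ k : ℕ, 1 ≤ k → homogeneousPart (k + 1) f ∈ C k

/-! ### The nilpotent with two Jordan blocks of size two -/

/-- The nilpotent matrix in Jordan form with two blocks of size two. -/
def N22 : Matrix (Fin 4) (Fin 4) ℝ :=
  !![0, 1, 0, 0;
     0, 0, 0, 0;
     0, 0, 0, 1;
     0, 0, 0, 0]

/-- The eight free functions in the normal form that belong to one Jordan block. `P m` is a type of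
functions of `m` variables (polynomials or formal power series). -/
structure Families (P : ℕ → Type) where
  /-- `F_{1,2}^0(x₁, x₂, x₃, x₄)` -/
  F12 : P 4
  /-- `F_{1,4}^0(x₁, x₃, x₄)` -/
  F14 : P 3
  /-- `F_{2,3}^0(x₂, x₃, x₄)` -/
  F23 : P 3
  /-- `F_{3,4}^0(x₃, x₄)` -/
  F34 : P 2
  /-- `F_1^0(x₁, x₃)` -/
  F10 : P 2
  /-- `F_1^1`, used at `(x₁, x₃)` and at `(x₂, x₄)` -/
  F11 : P 2
  /-- `F_3^0(x₃)` -/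
  F30 : P 1
  /-- `F_3^1`, used at `x₃` and at `x₄` -/
  F31 : P 1

/-- The first of the two components of a block:
`x₁ F_1^1(x₁, x₃) + x₃ F_3^1(x₃)`. Here `ev q v` is the value of the function `q` at `v`. -/
def upperComponent {P : ℕ → Type} {S : Type} [CommRing S]
    (ev : ∀ {m : ℕ}, P m → (Fin m → S) → S) (x₁ x₃ : S) (F : Families P) : S :=
  x₁ * ev F.F11 ![x₁, x₃] + x₃ * ev F.F31 ![x₃]

/-- The second of the two components of a block. -/
def lowerComponent {P : ℕ → Type} {S : Type} [CommRing S]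
    (ev : ∀ {m : ℕ}, P m → (Fin m → S) → S) (x₁ x₂ x₃ x₄ : S) (F : Families P) : S :=
  x₁ * x₂ * ev F.F12 ![x₁, x₂, x₃, x₄]
    + x₁ * x₄ * ev F.F14 ![x₁, x₃, x₄]
    + x₂ * x₃ * ev F.F23 ![x₂, x₃, x₄]
    + x₃ * x₄ * ev F.F34 ![x₃, x₄]
    + x₁ * ev F.F10 ![x₁, x₃]
    + x₂ * ev F.F11 ![x₂, x₄]
    + x₃ * ev F.F30 ![x₃]
    + x₄ * ev F.F31 ![x₄]

/-- Polynomials in `m` variables. -/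
abbrev Poly (m : ℕ) : Type := MvPolynomial (Fin m) ℝ

/-- Formal power series in `m` variables. -/
abbrev Series (m : ℕ) : Type := MvPowerSeries (Fin m) ℝ

/-- The list of terms of the normal form (all of it except the linear map `N22`), with polynomial
families `F` (first block) and `G` (second block). -/
def polyTerms (FG : Families Poly × Families Poly) : PolyMap 4 :=
  let x : Fin 4 → MvPolynomial (Fin 4) ℝ := MvPolynomial.X
  let ev : ∀ {m : ℕ}, Poly m → (Fin m → MvPolynomial (Fin 4) ℝ) → MvPolynomial (Fin 4) ℝ :=
    fun q v => MvPolynomial.aeval v q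
  ![upperComponent ev (x 0) (x 2) FG.1,
    lowerComponent ev (x 0) (x 1) (x 2) (x 3) FG.1,
    upperComponent ev (x 0) (x 2) FG.2,
    lowerComponent ev (x 0) (x 1) (x 2) (x 3) FG.2]

/-- The same list of terms with formal power series as families. -/
def formalTerms (FG : Families Series × Families Series) : FormalMap 4 :=
  let x : Fin 4 → MvPowerSeries (Fin 4) ℝ := MvPowerSeries.X
  let ev : ∀ {m : ℕ}, Series m → (Fin m → MvPowerSeries (Fin 4) ℝ) → MvPowerSeries (Fin 4) ℝ :=
    fun q v => MvPowerSeries.subst v q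
  ![upperComponent ev (x 0) (x 2) FG.1,
    lowerComponent ev (x 0) (x 1) (x 2) (x 3) FG.1,
    upperComponent ev (x 0) (x 2) FG.2,
    lowerComponent ev (x 0) (x 1) (x 2) (x 3) FG.2]

/-- The families contribute no linear terms. -/
def Families.NoLinearTerms (F : Families Series) : Prop :=
  MvPowerSeries.constantCoeff F.F10 = 0 ∧ MvPowerSeries.constantCoeff F.F11 = 0 ∧
    MvPowerSeries.constantCoeff F.F30 = 0 ∧ MvPowerSeries.constantCoeff F.F31 = 0

/-! ### Generating functions -/

/-- `∑_{d ≥ 1} dim (ker Δ_{M̄} in degree d) t^d`. -/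
def kernelSeries {n : ℕ} (N : Matrix (Fin n) (Fin n) ℝ) : PowerSeries ℤ :=
  PowerSeries.mk fun d => if d = 0 then 0 else
    (Module.finrank ℝ ↥(homogeneousMaps n d ⊓ LinearMap.ker (deltaBarM N)) : ℤ)

/-- `∑_{d ≥ 1} ∑_w m(d, w) u^w t^d`, where `m(d, w)` is the multiplicity of the eigenvalue `w` of
`sumBarH N` on the kernel of `Δ_{M̄}` in degree `d`. The variable `u` is `Polynomial.X`. -/
def weightedKernelSeries {n : ℕ} (N : Matrix (Fin n) (Fin n) ℝ) :
    PowerSeries (Polynomial ℤ) :=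
  PowerSeries.mk fun d => if d = 0 then 0 else
    ∑ᶠ w : ℕ, Polynomial.monomial w
      (Module.finrank ℝ ↥(homogeneousMaps n d ⊓ LinearMap.ker (deltaBarM N) ⊓
        Module.End.eigenspace (sumBarH N) (w : ℝ)) : ℤ)

/-- `∑_{d ≥ 0} dim (homogeneous maps of degree d) t^d`. -/
def allMapsSeries (n : ℕ) : PowerSeries ℤ :=
  PowerSeries.mk fun d => (Module.finrank ℝ ↥(homogeneousMaps n d) : ℤ)

/-- `∂/∂u (u G(u, t))` at `u = 1`. -/
def cushmanSanders (G : PowerSeries (Polynomial ℤ)) : PowerSeries ℤ :=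
  PowerSeries.mk fun d =>
    (Polynomial.derivative (Polynomial.X * PowerSeries.coeff d G)).eval 1

/-- `G(1, t)`. -/
def atOne (G : PowerSeries (Polynomial ℤ)) : PowerSeries ℤ :=
  PowerSeries.map (Polynomial.evalRingHom 1) G

/-- The power series `1 / (1 - t)^k`. -/
def geom (R : Type) [CommRing R] (k : ℕ) : PowerSeries R :=
  (PowerSeries.invOneSubPow R k : PowerSeries R)

/-- The variable `u`. -/
def uVar : PowerSeries (Polynomial ℤ) := PowerSeries.C Polynomial.X

/-- The variable `t`. -/
def tVar : PowerSeries (Polynomial ℤ) := PowerSeries.X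

/-- The generating function `G(u, t)` for `N22`: the series of the kernel in positive degrees,
with the conventional term `2u` in degree zero that accounts for the constant maps
`e₂` and `e₄`, which span `ker M_*` in degree zero and have `H_*`-eigenvalue `1`. -/
def G22 : PowerSeries (Polynomial ℤ) := 2 * uVar + weightedKernelSeries N22

end

end NilpotentMaps

open NilpotentMaps

/-!
The nilpotent matrix `N = N22` satisfies `N² = 0`, so `barM = M = Nᵀ` and `barH = M N - N M`, and
everything can be computed from the relations `N M N = N` and `N² = 0` between the linear
substitutions by `N` and `M`.

*The kernel.* `M φ(x) = φ(M x)` says, in each block `(φ₁, φ₂)`, that `φ₁(x) = φ₂(M x)`, the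
remaining condition `φ₁(M x) = 0` being automatic in the absence of constant terms
(`deltaBarM_N22_eq_zero_iff`). So the kernel is parametrized by the arbitrary second components.
The eight families are obtained by sorting the monomials of `φ₂` by the set of variables that occur
in them (`coeffAt_lowerSeries`), and substituting `M x` leaves only those in `x₂, x₄`
(`pullback_lowerSeries`).

*The splitting.* Write `ν, μ` for the substitutions of `N`, `M`. In each block one has to write a
given `(p, q)` as `(b, -ν b) + (μ c, c)`, that is, to solve `(1 + μ ν) b = p - μ q`. As `μ ν` is
idempotent, `b = (1 - μ ν / 2) (p - μ q)` (`potential_add`). Directness follows from `ν² = 0` in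
positive degree and `ν μ ν = ν` (`isStyle_kerStyle_N22`).

*Reduction to normal form.* The splitting also makes sense for formal power series and respects the
order of vanishing. With `f = N + w`, `φ = id + u` and `g = N + v`, the equation `φ ∘ f = g ∘ φ` is
a homological equation for `(u, v)` whose right-hand side depends on `(u, v)` only through terms of
higher order; solving it by the splitting gives a fixed point equation for a map that is
contractive in the order topology (`exists_intertwining`, `exists_fixedPoint`). Inverses of near
identity maps are obtained in the same way (`NearIdentity.exists_inverse`). The contraction
estimates all come from `le_order_subst_sub_subst`.

*Generating functions.* The operator `H̄_* + \overline{H^*}` acts on the element of the kernel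
with second component `x^k` by a weight in `{0, 1, 2}`, which is `2` if only `x₁, x₃` occur, `0` if
only `x₂, x₄` occur, and `1` otherwise (`coeff_weightOp`). In degree `d ≥ 1` this gives the
multiplicities `2 (d + 1)`, `2 (d + 1)` and `2 (binom (d + 3) 3 - 2 (d + 1))`, and the identities
between power series are compared coefficient by coefficient.
-/

namespace NilpotentMaps

section PowerSeriesMaps

open MvPowerSeries

/-! ### Order estimates for substitution -/

section Order

variable {σ τ : Type*}

lemma le_order_iff {f : MvPowerSeries σ ℝ} {e : ℕ} :
    (e : ℕ∞) ≤ f.order ↔ ∀ d : σ →₀ ℕ, d.degree < e → coeff d f = 0 := by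
  refine ⟨fun h d hd => coeff_of_lt_order (lt_of_lt_of_le (by exact_mod_cast hd) h),
    fun h => nat_le_order h⟩

lemma le_order_sub {f g : MvPowerSeries σ ℝ} {e : ℕ∞} (hf : e ≤ f.order) (hg : e ≤ g.order) :
    e ≤ (f - g).order := by
  rw [sub_eq_add_neg]
  exact (le_min hf (by rwa [order_neg])).trans min_order_le_add

lemma le_order_add {f g : MvPowerSeries σ ℝ} {e : ℕ∞} (hf : e ≤ f.order) (hg : e ≤ g.order) :
    e ≤ (f + g).order :=
  (le_min hf hg).trans min_order_le_add

lemma le_order_finsuppProd {a : σ → MvPowerSeries τ ℝ} (ha : ∀ i, 1 ≤ (a i).order)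
    (n : σ →₀ ℕ) : (n.degree : ℕ∞) ≤ (n.prod fun i k => a i ^ k).order := by
  rw [Finsupp.degree_apply, Finsupp.prod, Nat.cast_sum]
  refine le_trans (Finset.sum_le_sum fun i _ => ?_) (le_order_prod _ _)
  refine le_trans ?_ (le_order_pow _)
  simpa using mul_le_mul_right (ha i) (n i : ℕ∞)

/-- The product estimate behind `le_order_finsuppProd_sub`: if `aᵢ` and `bᵢ` have order `kᵢ` and
agree up to order `kᵢ - 1 + e`, then their products have order `k₁ + k₂` and agree up to order
`k₁ + k₂ - 1 + e`. The `+ 1` on the right avoids subtraction in `ℕ∞`. -/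
lemma le_order_mul_sub_mul {a₁ a₂ b₁ b₂ : MvPowerSeries τ ℝ} {k₁ k₂ e : ℕ∞}
    (h₁ : k₁ + e ≤ (a₁ - b₁).order + 1) (h₂ : k₂ + e ≤ (a₂ - b₂).order + 1)
    (ha₂ : k₂ ≤ a₂.order) (hb₁ : k₁ ≤ b₁.order) :
    k₁ + k₂ + e ≤ (a₁ * a₂ - b₁ * b₂).order + 1 := by
  have key : a₁ * a₂ - b₁ * b₂ = (a₁ - b₁) * a₂ + b₁ * (a₂ - b₂) := by ring
  rw [key]
  refine le_trans ?_ (add_le_add_left min_order_le_add 1)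
  rw [min_add]
  refine le_min ?_ ?_
  · calc k₁ + k₂ + e = (k₁ + e) + k₂ := by ac_rfl
      _ ≤ ((a₁ - b₁).order + 1) + a₂.order := add_le_add h₁ ha₂
      _ = ((a₁ - b₁).order + a₂.order) + 1 := by ac_rfl
      _ ≤ _ := add_le_add_left le_order_mul 1
  · calc k₁ + k₂ + e = k₁ + (k₂ + e) := by ac_rfl
      _ ≤ b₁.order + ((a₂ - b₂).order + 1) := add_le_add hb₁ h₂
      _ = (b₁.order + (a₂ - b₂).order) + 1 := by ac_rfl
      _ ≤ _ := add_le_add_left le_order_mul 1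

/-- Perturbing the variables, without constant term, by series of order `e` changes a monomial of
degree `k` by a series of order `k - 1 + e`. -/
lemma le_order_finsuppProd_sub {a b : σ → MvPowerSeries τ ℝ} {e : ℕ}
    (ha : ∀ i, 1 ≤ (a i).order) (hb : ∀ i, 1 ≤ (b i).order)
    (hab : ∀ i, (e : ℕ∞) ≤ (a i - b i).order) (n : σ →₀ ℕ) :
    (n.degree : ℕ∞) + e ≤
      ((n.prod fun i k => a i ^ k) - n.prod fun i k => b i ^ k).order + 1 := by
  classical
  induction n using Finsupp.induction_linear with
  | zero => simp
  | add f g hf hg =>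
    rw [Finsupp.prod_add_index' (by simp) (by intros; rw [pow_add]),
      Finsupp.prod_add_index' (by simp) (by intros; rw [pow_add]), map_add, Nat.cast_add]
    exact le_order_mul_sub_mul hf hg (le_order_finsuppProd ha g) (le_order_finsuppProd hb f)
  | single i k =>
    rw [Finsupp.prod_single_index (by simp), Finsupp.prod_single_index (by simp),
      Finsupp.degree_single]
    induction k with
    | zero => simp
    | succ k ih =>
      rw [pow_succ, pow_succ, Nat.cast_add, Nat.cast_one]
      refine le_order_mul_sub_mul ih ?_ (ha i) ?_
      · rw [add_comm]; exact add_le_add_left (hab i) 1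
      · refine le_trans ?_ (le_order_pow _)
        simpa using mul_le_mul_right (hb i) (k : ℕ∞)

/-- If two substitutions agree up to order `e`, then substituting them into a series of order `m`
gives results that agree up to order `m - 1 + e`. -/
lemma le_order_subst_sub_subst [Finite σ] {a b : σ → MvPowerSeries τ ℝ} {m e : ℕ}
    (ha : ∀ i, 1 ≤ (a i).order) (hb : ∀ i, 1 ≤ (b i).order)
    (hab : ∀ i, (e : ℕ∞) ≤ (a i - b i).order) {g : MvPowerSeries σ ℝ} (hg : (m : ℕ∞) ≤ g.order) :
    (m + e : ℕ∞) ≤ (subst a g - subst b g).order + 1 := by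
  have ha' : HasSubst a :=
    hasSubst_of_constantCoeff_zero fun i => one_le_order_iff_constCoeff_eq_zero.1 (ha i)
  have hb' : HasSubst b :=
    hasSubst_of_constantCoeff_zero fun i => one_le_order_iff_constCoeff_eq_zero.1 (hb i)
  suffices h : ((m + e - 1 : ℕ) : ℕ∞) ≤ (subst a g - subst b g).order by
    refine le_trans ?_ (add_le_add_left h 1)
    norm_cast
    omega
  refine nat_le_order fun k hk => ?_
  rw [map_sub, sub_eq_zero, coeff_subst ha', coeff_subst hb']
  -- the coefficients are compared term by term, so no finiteness has to be checked
  refine finsum_congr fun d => ?_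
  by_cases hd : d.degree < m
  · rw [le_order_iff.1 hg d hd, zero_smul, zero_smul]
  · congr 1
    rw [← sub_eq_zero, ← map_sub]
    refine coeff_of_lt_order ?_
    have := le_order_finsuppProd_sub ha hb hab d
    have h2 : ((k.degree + 2 : ℕ) : ℕ∞) ≤
        ((d.prod fun i k => a i ^ k) - d.prod fun i k => b i ^ k).order + 1 :=
      le_trans (by norm_cast; omega) this
    have h3 : ((k.degree + 1 : ℕ) : ℕ∞) ≤
        ((d.prod fun i k => a i ^ k) - d.prod fun i k => b i ^ k).order := by
      push_cast at h2 ⊢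
      exact (ENat.add_le_add_iff_right ENat.one_ne_top).1 (by rwa [add_assoc, one_add_one_eq_two])
    exact lt_of_lt_of_le (by exact_mod_cast Nat.lt_succ_self _) h3

lemma le_order_subst_of_le [Finite σ] {a : σ → MvPowerSeries τ ℝ} (ha : ∀ i, 1 ≤ (a i).order)
    {m : ℕ} {g : MvPowerSeries σ ℝ} (hg : (m : ℕ∞) ≤ g.order) : (m : ℕ∞) ≤ (subst a g).order := by
  have ha' : HasSubst a :=
    hasSubst_of_constantCoeff_zero fun i => one_le_order_iff_constCoeff_eq_zero.1 (ha i)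
  refine nat_le_order fun k hk => ?_
  rw [coeff_subst ha']
  refine finsum_eq_zero_of_forall_eq_zero fun d => ?_
  by_cases hd : d.degree < m
  · rw [le_order_iff.1 hg d hd, zero_smul]
  · rw [coeff_of_lt_order (lt_of_lt_of_le (by exact_mod_cast (by omega : k.degree < d.degree))
      (le_order_finsuppProd ha d)), smul_zero]

end Order

/-! ### Formal maps and contractions in the order topology -/

section Contraction

variable {n : ℕ}

/-- All components of the formal map `f` have order at least `e`. -/
def OrderGE (e : ℕ) (f : FormalMap n) : Prop := ∀ i, (e : ℕ∞) ≤ (f i).order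

lemma orderGE_iff {e : ℕ} {f : FormalMap n} :
    OrderGE e f ↔ ∀ i (d : Fin n →₀ ℕ), d.degree < e → coeff d (f i) = 0 :=
  forall_congr' fun _ => le_order_iff

lemma OrderGE.mono {e e' : ℕ} {f : FormalMap n} (h : OrderGE e f) (he : e' ≤ e) : OrderGE e' f :=
  fun i => le_trans (by exact_mod_cast he) (h i)

lemma OrderGE.add {e : ℕ} {f g : FormalMap n} (hf : OrderGE e f) (hg : OrderGE e g) :
    OrderGE e (f + g) := fun i => le_order_add (hf i) (hg i)

lemma OrderGE.sub {e : ℕ} {f g : FormalMap n} (hf : OrderGE e f) (hg : OrderGE e g) :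
    OrderGE e (f - g) := fun i => le_order_sub (hf i) (hg i)

lemma OrderGE.neg {e : ℕ} {f : FormalMap n} (hf : OrderGE e f) : OrderGE e (-f) :=
  fun i => by rw [Pi.neg_apply, order_neg]; exact hf i

lemma orderGE_zero (e : ℕ) : OrderGE e (0 : FormalMap n) := fun i => by simp

lemma fixesZero_iff_orderGE {f : FormalMap n} : FixesZero f ↔ OrderGE 1 f :=
  forall_congr' fun i => by rw [Nat.cast_one, one_le_order_iff_constCoeff_eq_zero]

lemma OrderGE.hasSubst {a : FormalMap n} (ha : OrderGE 1 a) : HasSubst a :=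
  hasSubst_of_constantCoeff_zero (fixesZero_iff_orderGE.2 ha)

lemma OrderGE.comp {e : ℕ} {g a : FormalMap n} (hg : OrderGE e g) (ha : OrderGE 1 a) :
    OrderGE e (comp g a) := fun i => le_order_subst_of_le ha (hg i)

/-- Composition from the left with a map of order `m + 1` is Lipschitz, gaining `m` orders. -/
lemma OrderGE.comp_sub_comp {m e : ℕ} {g a b : FormalMap n} (hg : OrderGE (m + 1) g)
    (ha : OrderGE 1 a) (hb : OrderGE 1 b) (hab : OrderGE e (a - b)) :
    OrderGE (m + e) (NilpotentMaps.comp g a - NilpotentMaps.comp g b) := fun i => by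
  have := le_order_subst_sub_subst ha hb hab (hg i)
  push_cast at this ⊢
  exact (ENat.add_le_add_iff_right ENat.one_ne_top).1 (by rwa [add_right_comm])

lemma comp_add {f g a : FormalMap n} (ha : OrderGE 1 a) :
    comp (f + g) a = comp f a + comp g a := funext fun _ => subst_add ha.hasSubst _ _

lemma comp_sub {f g a : FormalMap n} (ha : OrderGE 1 a) :
    comp (f - g) a = comp f a - comp g a := funext fun _ => subst_sub ha.hasSubst _ _

lemma idMap_comp {a : FormalMap n} (ha : OrderGE 1 a) : comp (idMap n) a = a :=
  funext fun i => subst_X ha.hasSubst i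

lemma comp_idMap (f : FormalMap n) : comp f (idMap n) = f :=
  funext fun i => congrFun (subst_self (R := ℝ) (σ := Fin n)) (f i)

lemma comp_assoc {f g h : FormalMap n} (hg : OrderGE 1 g) (hh : OrderGE 1 h) :
    comp (comp f g) h = comp f (comp g h) :=
  funext fun i => subst_comp_subst_apply hg.hasSubst hh.hasSubst (f i)

lemma linearMap_comp (A : Matrix (Fin n) (Fin n) ℝ) {a : FormalMap n} (ha : OrderGE 1 a) :
    comp (linearMap A) a = fun i => ∑ j, A i j • a j := by
  funext i
  change subst a (∑ j, A i j • X j) = _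
  rw [← coe_substAlgHom ha.hasSubst, map_sum]
  exact Finset.sum_congr rfl fun j _ => by rw [map_smul, substAlgHom_X]

lemma coeff_linearMap_single (A : Matrix (Fin n) (Fin n) ℝ) (i j : Fin n) :
    coeff (Finsupp.single j 1) (linearMap A i) = A i j := by
  classical
  simp [linearMap, coeff_X, Finsupp.single_left_inj]

lemma coeff_linearMap_of_ne (A : Matrix (Fin n) (Fin n) ℝ) (i : Fin n) {d : Fin n →₀ ℕ}
    (hd : d.degree ≠ 1) : coeff d (linearMap A i) = 0 := by
  classical
  simp only [linearMap, map_sum, coeff_smul, coeff_X]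
  refine Finset.sum_eq_zero fun j _ => ?_
  rw [if_neg, mul_zero]
  rintro rfl
  exact hd (Finsupp.degree_single _ _)

lemma orderGE_linearMap (A : Matrix (Fin n) (Fin n) ℝ) : OrderGE 1 (linearMap A) :=
  orderGE_iff.2 fun _ _ hd => coeff_linearMap_of_ne _ _ (by omega)

lemma linearMap_one : linearMap (1 : Matrix (Fin n) (Fin n) ℝ) = idMap n := by
  funext i
  simp [linearMap, idMap, Matrix.one_apply]

lemma orderGE_idMap : OrderGE 1 (idMap n) := linearMap_one (n := n) ▸ orderGE_linearMap 1

/-- A formal map fixes the origin and has linear part `A` exactly if it differs from `A` by terms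
of order at least two. -/
lemma fixesZero_and_jacobian_iff {f : FormalMap n} {A : Matrix (Fin n) (Fin n) ℝ} :
    FixesZero f ∧ jacobianAtZero f = A ↔ OrderGE 2 (f - linearMap A) := by
  rw [orderGE_iff]
  constructor
  · rintro ⟨h0, rfl⟩ i d hd
    rw [Pi.sub_apply, map_sub, sub_eq_zero]
    obtain hd | hd : d.degree = 0 ∨ d.degree = 1 := by omega
    · rw [coeff_linearMap_of_ne _ _ (by omega), (Finsupp.degree_eq_zero_iff d).1 hd]
      exact h0 i
    · obtain ⟨j, rfl⟩ : d ∈ Set.range fun j : Fin n => Finsupp.single j 1 := by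
        rw [Finsupp.range_single_one]
        exact hd
      rw [coeff_linearMap_single]
      rfl
  · intro h
    refine ⟨fun i => ?_, ?_⟩
    · have := h i 0 (by simp)
      rwa [Pi.sub_apply, map_sub, coeff_linearMap_of_ne _ _ (by simp), sub_zero] at this
    · ext i j
      have := h i (Finsupp.single j 1) (by simp [Finsupp.degree_single])
      rwa [Pi.sub_apply, map_sub, coeff_linearMap_single, sub_eq_zero] at this

lemma nearIdentity_iff {φ : FormalMap n} : NearIdentity φ ↔ OrderGE 2 (φ - idMap n) := by
  rw [← linearMap_one, ← fixesZero_and_jacobian_iff, NearIdentity]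

lemma OrderGE.one_of_sub {f g : FormalMap n} (hg : OrderGE 1 g) (h : OrderGE 2 (f - g)) :
    OrderGE 1 f := by
  simpa using (h.mono one_le_two).add hg

/-- A map that preserves the formal maps of order at least `c` and raises the order of agreement
has a fixed point among them. -/
theorem exists_fixedPoint {c : ℕ} (T : FormalMap n → FormalMap n)
    (hT : ∀ a, OrderGE c a → OrderGE c (T a))
    (hc : ∀ a b e, OrderGE c a → OrderGE c b → OrderGE e (a - b) →
      OrderGE (e + 1) (T a - T b)) :
    ∃ a, OrderGE c a ∧ T a = a := by
  set s : ℕ → FormalMap n := fun k => T^[k] 0 with hs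
  have hs_succ : ∀ k, s (k + 1) = T (s k) := fun k => Function.iterate_succ_apply' T k 0
  have hsc : ∀ k, OrderGE c (s k) := by
    intro k
    induction k with
    | zero => exact orderGE_zero c
    | succ k ih => rw [hs_succ]; exact hT _ ih
  have step : ∀ k, OrderGE k (s (k + 1) - s k) := by
    intro k
    induction k with
    | zero => exact fun i => by simp
    | succ k ih => 
      have := hc _ _ _ (hsc (k + 1)) (hsc k) ih
      rwa [← hs_succ, ← hs_succ] at this
  have stab : ∀ k j, OrderGE k (s (k + j) - s k) := by
    intro k j
    induction j with
    | zero => simpa using orderGE_zero k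
    | succ j ih =>
      have := ((step (k + j)).mono (Nat.le_add_right k j)).add ih
      rwa [sub_add_sub_cancel] at this
  -- the coefficients in degree `d` are stationary from the `(d + 1)`-st iterate on
  let a : FormalMap n := fun i d => coeff d (s (d.degree + 1) i)
  have ha : ∀ k, OrderGE k (a - s k) := by
    refine fun k => orderGE_iff.2 fun i d hd => ?_
    obtain ⟨j, rfl⟩ := Nat.exists_eq_add_of_le (Nat.succ_le_of_lt hd)
    have := orderGE_iff.1 (stab (d.degree + 1) j) i d (Nat.lt_succ_self _)
    rw [Pi.sub_apply, map_sub, sub_eq_zero] at this ⊢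
    exact this.symm
  have hac : OrderGE c a := by
    simpa using (ha c).add (hsc c)
  refine ⟨a, hac, ?_⟩
  have hTa : ∀ k, OrderGE k (T a - a) := by
    intro k
    have h1 := (hc a (s k) k hac (hsc k) (ha k)).mono (Nat.le_succ k)
    have h2 := (ha (k + 1)).mono (Nat.le_succ k)
    rw [hs_succ] at h2
    have := h1.sub h2
    rwa [sub_sub_sub_cancel_right] at this
  funext i
  ext d
  have := orderGE_iff.1 (hTa (d.degree + 1)) i d (Nat.lt_succ_self _)
  rwa [Pi.sub_apply, map_sub, sub_eq_zero] at this

/-- Near identity maps have near identity right inverses: writing `φ = id + h`, the inverse is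
`id + s` with `s = -h ∘ (id + s)`, which is a contraction since `h` has order two. -/
lemma NearIdentity.exists_rightInverse {φ : FormalMap n} (hφ : NearIdentity φ) :
    ∃ ψ, NearIdentity ψ ∧ comp φ ψ = idMap n := by
  have hh := nearIdentity_iff.1 hφ
  have hid : ∀ {s : FormalMap n}, OrderGE 2 s → OrderGE 1 (idMap n + s) := fun hs =>
    orderGE_idMap.add (hs.mono one_le_two)
  obtain ⟨s, hs, hfix⟩ := exists_fixedPoint (c := 2)
    (fun s => -comp (φ - idMap n) (idMap n + s)) (fun s hs => (hh.comp (hid hs)).neg)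
    (fun a b e ha hb hab => by
      have := OrderGE.comp_sub_comp (m := 1) (e := e) hh (hid hb) (hid ha)
        (by simpa [add_sub_add_left_eq_sub] using hab.neg)
      rw [add_comm 1 e] at this
      rwa [neg_sub_neg])
  refine ⟨idMap n + s, nearIdentity_iff.2 (by simpa using hs), ?_⟩
  have : comp φ (idMap n + s) = comp (φ - idMap n) (idMap n + s) + (idMap n + s) := by
    rw [comp_sub (hid hs), idMap_comp (hid hs), sub_add_cancel]
  rw [this, neg_eq_iff_eq_neg.1 hfix]
  abel

lemma NearIdentity.orderGE {φ : FormalMap n} (hφ : NearIdentity φ) : OrderGE 1 φ :=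
  fixesZero_iff_orderGE.1 hφ.1

/-- Near identity maps are invertible in the group of near identity maps. -/
theorem NearIdentity.exists_inverse {φ : FormalMap n} (hφ : NearIdentity φ) :
    ∃ ψ, NearIdentity ψ ∧ comp φ ψ = idMap n ∧ comp ψ φ = idMap n := by
  obtain ⟨ψ, hψ, h1⟩ := hφ.exists_rightInverse
  obtain ⟨χ, hχ, h2⟩ := hψ.exists_rightInverse
  refine ⟨ψ, hψ, h1, ?_⟩
  -- a left and a right inverse of `ψ` coincide
  have : φ = χ := by
    rw [← comp_idMap φ, ← h2, ← comp_assoc hψ.orderGE hχ.orderGE, h1, idMap_comp hχ.orderGE]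
  rw [this, h2]

end Contraction

/-! ### Linear substitutions -/

section Pullback

variable {n : ℕ}

/-- The substitution `f ↦ f(A x)` on formal power series, as an algebra homomorphism. -/
noncomputable def pullback (A : Matrix (Fin n) (Fin n) ℝ) :
    MvPowerSeries (Fin n) ℝ →ₐ[ℝ] MvPowerSeries (Fin n) ℝ :=
  substAlgHom (orderGE_linearMap A).hasSubst

/-- The substitution `f ↦ f(A x)` on polynomials, as an algebra homomorphism. -/
noncomputable def polyPullback (A : Matrix (Fin n) (Fin n) ℝ) :
    MvPolynomial (Fin n) ℝ →ₐ[ℝ] MvPolynomial (Fin n) ℝ :=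
  MvPolynomial.aeval fun j => ∑ l, A j l • MvPolynomial.X l

lemma pullback_apply (A : Matrix (Fin n) (Fin n) ℝ) (f : MvPowerSeries (Fin n) ℝ) :
    pullback A f = subst (linearMap A) f := by
  rw [pullback, coe_substAlgHom]

lemma pullback_X (A : Matrix (Fin n) (Fin n) ℝ) (i : Fin n) :
    pullback A (X i) = linearMap A i := substAlgHom_X _ _

lemma comp_linearMap (A : Matrix (Fin n) (Fin n) ℝ) (f : FormalMap n) :
    comp f (linearMap A) = fun i => pullback A (f i) :=
  funext fun _ => (pullback_apply _ _).symm

lemma linearMap_comp_linearMap (A B : Matrix (Fin n) (Fin n) ℝ) :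
    comp (linearMap B) (linearMap A) = linearMap (B * A) := by
  rw [linearMap_comp _ (orderGE_linearMap A)]
  funext i
  simp only [linearMap, Finset.smul_sum, Matrix.mul_apply, Finset.sum_smul, smul_smul]
  exact Finset.sum_comm

lemma pullback_pullback (A B : Matrix (Fin n) (Fin n) ℝ) (f : MvPowerSeries (Fin n) ℝ) :
    pullback A (pullback B f) = pullback (B * A) f := by
  simp only [pullback_apply]
  rw [subst_comp_subst_apply (orderGE_linearMap B).hasSubst (orderGE_linearMap A).hasSubst,
    ← linearMap_comp_linearMap]
  rfl

lemma le_order_pullback (A : Matrix (Fin n) (Fin n) ℝ) {f : MvPowerSeries (Fin n) ℝ} {e : ℕ}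
    (hf : (e : ℕ∞) ≤ f.order) : (e : ℕ∞) ≤ (pullback A f).order := by
  rw [pullback_apply]
  exact le_order_subst_of_le (orderGE_linearMap A) hf

lemma algHom_eq_coe {m : ℕ} (p : MvPolynomial (Fin m) ℝ) :
    MvPolynomial.coeToMvPowerSeries.algHom ℝ p = (p : MvPowerSeries (Fin m) ℝ) := by
  simp

lemma coe_aeval {m : ℕ} (v : Fin m → MvPolynomial (Fin n) ℝ) (p : MvPolynomial (Fin m) ℝ) :
    (MvPolynomial.aeval v p : MvPowerSeries (Fin n) ℝ) =
      subst (fun i => (v i : MvPowerSeries (Fin n) ℝ)) (p : MvPowerSeries (Fin m) ℝ) := by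
  rw [subst_coe, ← algHom_eq_coe, MvPolynomial.comp_aeval_apply]
  simp only [algHom_eq_coe]

lemma coe_polyPullback (A : Matrix (Fin n) (Fin n) ℝ) (p : MvPolynomial (Fin n) ℝ) :
    (polyPullback A p : MvPowerSeries (Fin n) ℝ) = pullback A (p : MvPowerSeries (Fin n) ℝ) := by
  rw [polyPullback, coe_aeval, pullback_apply]
  congr 1
  funext i
  rw [← algHom_eq_coe, map_sum]
  simp only [map_smul, algHom_eq_coe, MvPolynomial.coe_X, linearMap]

lemma polyPullback_polyPullback (A B : Matrix (Fin n) (Fin n) ℝ) (p : MvPolynomial (Fin n) ℝ) :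
    polyPullback A (polyPullback B p) = polyPullback (B * A) p := by
  rw [← MvPolynomial.coe_inj]
  simp only [coe_polyPullback, pullback_pullback]

lemma isHomogeneous_linear (A : Matrix (Fin n) (Fin n) ℝ) (i : Fin n) :
    (∑ l, A i l • (MvPolynomial.X l : MvPolynomial (Fin n) ℝ)).IsHomogeneous 1 :=
  MvPolynomial.IsHomogeneous.sum _ _ _ fun l _ =>
    (MvPolynomial.homogeneousSubmodule (Fin n) ℝ 1).smul_mem _ (MvPolynomial.isHomogeneous_X ℝ l)

lemma isHomogeneous_polyPullback (A : Matrix (Fin n) (Fin n) ℝ) {p : MvPolynomial (Fin n) ℝ}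
    {d : ℕ} (hp : p.IsHomogeneous d) : (polyPullback A p).IsHomogeneous d := by
  simpa [polyPullback] using hp.aeval _ (fun i => isHomogeneous_linear A i)

lemma coe_linear (A : Matrix (Fin n) (Fin n) ℝ) (i : Fin n) :
    ((∑ l, A i l • (MvPolynomial.X l : MvPolynomial (Fin n) ℝ) : MvPolynomial (Fin n) ℝ) :
      MvPowerSeries (Fin n) ℝ) = linearMap A i := by
  rw [← pullback_X, ← MvPolynomial.coe_X, ← coe_polyPullback, polyPullback, MvPolynomial.aeval_X]

/-- A linear substitution does not mix degrees. -/
lemma coeff_pullback_congr (A : Matrix (Fin n) (Fin n) ℝ) {f g : MvPowerSeries (Fin n) ℝ}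
    {k : Fin n →₀ ℕ} (h : ∀ d : Fin n →₀ ℕ, d.degree = k.degree → coeff d f = coeff d g) :
    coeff k (pullback A f) = coeff k (pullback A g) := by
  have hA := (orderGE_linearMap A).hasSubst
  rw [pullback_apply, pullback_apply, coeff_subst hA, coeff_subst hA]
  refine finsum_congr fun d => ?_
  by_cases hd : d.degree = k.degree
  · rw [h d hd]
  have key : coeff k (d.prod fun i e => linearMap A i ^ e) = 0 := by
    have hprod : (d.prod fun i e => linearMap A i ^ e) =
        ((d.prod fun i e => (∑ l, A i l • (MvPolynomial.X l : MvPolynomial (Fin n) ℝ)) ^ e :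
          MvPolynomial (Fin n) ℝ) : MvPowerSeries (Fin n) ℝ) := by
      rw [Finsupp.prod, Finsupp.prod]
      have := map_prod (MvPolynomial.coeToMvPowerSeries.ringHom (R := ℝ) (σ := Fin n))
        (fun i => (∑ l, A i l • (MvPolynomial.X l : MvPolynomial (Fin n) ℝ)) ^ d i) d.support
      simp only [map_pow, MvPolynomial.coeToMvPowerSeries.ringHom_apply, coe_linear] at this
      exact this.symm
    rw [hprod, MvPolynomial.coeff_coe]
    have hom : (d.prod fun i e => (∑ l, A i l • (MvPolynomial.X l : MvPolynomial (Fin n) ℝ)) ^ e :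
        MvPolynomial (Fin n) ℝ).IsHomogeneous d.degree := by
      rw [Finsupp.degree_apply]
      refine MvPolynomial.IsHomogeneous.prod _ _ _ fun i _ => ?_
      simpa using (isHomogeneous_linear A i).pow (d i)
    exact hom.coeff_eq_zero (Ne.symm hd)
  rw [key, smul_zero, smul_zero]

lemma coeff_homogeneousPart (d : ℕ) (f : FormalMap n) (i : Fin n) (k : Fin n →₀ ℕ) :
    MvPolynomial.coeff k (homogeneousPart d f i) =
      if k.degree = d then coeff k (f i) else 0 := by
  rw [homogeneousPart, MvPolynomial.coeff_homogeneousComponent]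
  split_ifs with h
  · exact coeff_truncTotal _ (by omega)
  · rfl

end Pullback

/-! ### The matrix `N22` and its operators -/

section Matrices

/-- The transpose of `N22`. -/
abbrev M22 : Matrix (Fin 4) (Fin 4) ℝ := N22.transpose

lemma N22_mul_N22 : N22 * N22 = 0 := by
  ext i j
  fin_cases i <;> fin_cases j <;> simp [N22, Matrix.mul_apply, Fin.sum_univ_four]

lemma N22_mul_M22_mul_N22 : N22 * (M22 * N22) = N22 := by
  ext i j
  fin_cases i <;> fin_cases j <;> simp [N22, Matrix.mul_apply, Fin.sum_univ_four]

lemma nilpotencyClass_N22 : nilpotencyClass N22 = 2 := by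
  rw [nilpotencyClass_eq_succ_iff]
  refine ⟨by rw [pow_two, N22_mul_N22], fun h1 => ?_⟩
  have := congrFun (congrFun h1 0) 1
  simp [N22] at this

lemma sum_N22 {V : Type*} [AddCommGroup V] [Module ℝ V] (v : Fin 4 → V) (i : Fin 4) :
    ∑ j, N22 i j • v j = ![v 1, 0, v 3, 0] i := by
  fin_cases i <;> simp [N22, Fin.sum_univ_four]

lemma sum_M22 {V : Type*} [AddCommGroup V] [Module ℝ V] (v : Fin 4 → V) (i : Fin 4) :
    ∑ j, M22 i j • v j = ![0, v 0, 0, v 2] i := by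
  fin_cases i <;> simp [N22, Fin.sum_univ_four]

lemma linearMap_M22 : linearMap M22 = ![0, X 0, 0, X 2] := by
  funext i
  rw [linearMap, sum_M22]

lemma multOp_apply {n : ℕ} (A : Matrix (Fin n) (Fin n) ℝ) (φ : PolyMap n) (i : Fin n) :
    multOp A φ i = ∑ j, A i j • φ j := by
  simp [multOp]

lemma substOp_apply {n : ℕ} (A : Matrix (Fin n) (Fin n) ℝ) (φ : PolyMap n) (i : Fin n) :
    substOp A φ i = polyPullback A (φ i) := rfl

lemma homologicalOp_N22_apply (φ : PolyMap 4) :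
    homologicalOp N22 φ = ![φ 1 - polyPullback N22 (φ 0), -polyPullback N22 (φ 1),
      φ 3 - polyPullback N22 (φ 2), -polyPullback N22 (φ 3)] := by
  funext i
  rw [homologicalOp, LinearMap.sub_apply, Pi.sub_apply, multOp_apply, substOp_apply, sum_N22]
  fin_cases i <;> simp

lemma deltaBarM_N22 : deltaBarM N22 = homologicalOp M22 := by
  simp [deltaBarM, barM, nilpotencyClass_N22, homologicalOp]

lemma deltaBarM_N22_apply (φ : PolyMap 4) :
    deltaBarM N22 φ = ![-polyPullback M22 (φ 0), φ 0 - polyPullback M22 (φ 1),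
      -polyPullback M22 (φ 2), φ 2 - polyPullback M22 (φ 3)] := by
  funext i
  rw [deltaBarM_N22, homologicalOp, LinearMap.sub_apply, Pi.sub_apply, multOp_apply, substOp_apply,
    sum_M22]
  fin_cases i <;> simp

lemma polyPullback_zero_matrix {n : ℕ} (p : MvPolynomial (Fin n) ℝ) :
    polyPullback 0 p = MvPolynomial.C (MvPolynomial.constantCoeff p) := by
  simp only [polyPullback, Matrix.zero_apply, zero_smul, Finset.sum_const_zero,
    MvPolynomial.aeval_zero', MvPolynomial.algebraMap_eq]

lemma M22_mul_M22 : M22 * M22 = 0 := by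
  rw [M22, ← Matrix.transpose_mul, N22_mul_N22, Matrix.transpose_zero]

/-- Without constant terms, an element of the kernel of `Δ_M̄` is determined by its second
component in each block, which is arbitrary. -/
lemma deltaBarM_N22_eq_zero_iff {φ : PolyMap 4}
    (h1 : MvPolynomial.constantCoeff (φ 1) = 0) (h3 : MvPolynomial.constantCoeff (φ 3) = 0) :
    deltaBarM N22 φ = 0 ↔ φ 0 = polyPullback M22 (φ 1) ∧ φ 2 = polyPullback M22 (φ 3) := by
  rw [deltaBarM_N22_apply]
  constructor
  · intro h
    exact ⟨sub_eq_zero.1 (congrFun h 1), sub_eq_zero.1 (congrFun h 3)⟩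
  · rintro ⟨h0, h2⟩
    rw [h0, h2]
    funext i
    fin_cases i <;> simp [polyPullback_polyPullback, M22_mul_M22, polyPullback_zero_matrix, h1, h3]

end Matrices

/-! ### The splitting -/

section Splitting

variable {V : Type*} [AddCommGroup V] [Module ℝ V]

/-- The second component of the solution with vanishing first component of the homological equation
with right-hand side `(p, q)` in one block. The operators `ν` and `μ` stand for the substitutions
of `N22` and of its transpose. Since `μ ν` is idempotent, `1 - μ ν / 2` is the inverse of
`1 + μ ν`. -/
noncomputable def potential (ν μ : V →ₗ[ℝ] V) (p q : V) : V :=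
  (p - μ q) - (1 / 2 : ℝ) • μ (ν (p - μ q))

lemma potential_add (ν μ : V →ₗ[ℝ] V) (h : ∀ v, ν (μ (ν v)) = ν v) (p q : V) :
    potential ν μ p q + μ (q + ν (potential ν μ p q)) = p := by
  simp only [potential, map_add, map_sub, map_smul, h]
  module

end Splitting

theorem isStyle_kerStyle_N22 : IsStyle N22 (kerStyle N22) := by
  intro k
  have hNMN : ∀ p, polyPullback N22 (polyPullback M22 (polyPullback N22 p)) =
      polyPullback N22 p := fun p => by
    rw [polyPullback_polyPullback, polyPullback_polyPullback, N22_mul_M22_mul_N22]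
  have hc : ∀ {p : MvPolynomial (Fin 4) ℝ}, p.IsHomogeneous (k + 1) →
      MvPolynomial.constantCoeff p = 0 := fun hp => by
    rw [MvPolynomial.constantCoeff_eq]
    exact hp.coeff_eq_zero (by simp)
  have hmem : ∀ {φ : PolyMap 4}, φ ∈ homogeneousMaps 4 (k + 1) ↔
      ∀ i, (φ i).IsHomogeneous (k + 1) := fun {φ} => by
    simp [homogeneousMaps, Submodule.mem_pi, MvPolynomial.mem_homogeneousSubmodule]
  refine ⟨?_, le_antisymm (sup_le ?_ inf_le_left) ?_⟩
  · rw [Submodule.disjoint_def]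
    rintro _ ⟨φ, hφ, rfl⟩ ⟨hψ, hker⟩
    rw [SetLike.mem_coe, hmem] at hφ
    rw [SetLike.mem_coe, hmem] at hψ
    rw [SetLike.mem_coe, LinearMap.mem_ker, deltaBarM_N22_eq_zero_iff (hc (hψ 1)) (hc (hψ 3)),
      homologicalOp_N22_apply] at hker
    -- applying `N` to the first equation, where `N N = 0` and `N M N = N`
    have block : ∀ a b : MvPolynomial (Fin 4) ℝ, a.IsHomogeneous (k + 1) →
        b - polyPullback N22 a = polyPullback M22 (-polyPullback N22 b) →
        b - polyPullback N22 a = 0 ∧ polyPullback N22 b = 0 := by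
      intro a b ha h
      have h2 := congrArg (polyPullback N22) h
      rw [map_sub, map_neg, map_neg, hNMN, polyPullback_polyPullback, N22_mul_N22,
        polyPullback_zero_matrix, hc ha, map_zero, sub_zero, self_eq_neg] at h2
      rw [h, h2]
      simp
    obtain ⟨hb0, hb1⟩ := block _ _ (hφ 0) hker.1
    obtain ⟨hb2, hb3⟩ := block _ _ (hφ 2) hker.2
    rw [homologicalOp_N22_apply, hb0, hb1, hb2, hb3]
    funext i
    fin_cases i <;> simp
  · rintro _ ⟨φ, hφ, rfl⟩
    rw [SetLike.mem_coe, hmem] at hφ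
    rw [hmem, homologicalOp_N22_apply]
    have hN := fun i => isHomogeneous_polyPullback N22 (hφ i)
    intro i
    fin_cases i
    · exact (hφ 1).sub (hN 0)
    · exact (hN 1).neg
    · exact (hφ 3).sub (hN 2)
    · exact (hN 3).neg
  · intro φ hφ
    rw [hmem] at hφ
    let ν := (polyPullback N22).toLinearMap
    let μ := (polyPullback M22).toLinearMap
    have hb : ∀ {p q : MvPolynomial (Fin 4) ℝ}, p.IsHomogeneous (k + 1) → q.IsHomogeneous (k + 1) →
        (potential ν μ p q).IsHomogeneous (k + 1) := fun hp hq => by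
      have h1 := hp.sub (isHomogeneous_polyPullback M22 hq)
      exact h1.sub ((MvPolynomial.homogeneousSubmodule (Fin 4) ℝ (k + 1)).smul_mem _
        (isHomogeneous_polyPullback M22 (isHomogeneous_polyPullback N22 h1)))
    set b := potential ν μ (φ 0) (φ 1) with hbdef
    set b' := potential ν μ (φ 2) (φ 3) with hbdef'
    have hb1 : b.IsHomogeneous (k + 1) := hb (hφ 0) (hφ 1)
    have hb2 : b'.IsHomogeneous (k + 1) := hb (hφ 2) (hφ 3)
    have hc1 := (hφ 1).add (isHomogeneous_polyPullback N22 hb1)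
    have hc2 := (hφ 3).add (isHomogeneous_polyPullback N22 hb2)
    refine Submodule.mem_sup.2 ⟨homologicalOp N22 ![0, b, 0, b'], ⟨_, hmem.2 ?_, rfl⟩,
      ![polyPullback M22 (φ 1 + polyPullback N22 b), φ 1 + polyPullback N22 b,
        polyPullback M22 (φ 3 + polyPullback N22 b'), φ 3 + polyPullback N22 b'],
      ⟨hmem.2 ?_, ?_⟩, ?_⟩
    · intro i
      fin_cases i
      exacts [MvPolynomial.isHomogeneous_zero _ _ _, hb1,
        MvPolynomial.isHomogeneous_zero _ _ _, hb2]
    · intro i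
      fin_cases i
      exacts [isHomogeneous_polyPullback _ hc1, hc1, isHomogeneous_polyPullback _ hc2, hc2]
    · exact (deltaBarM_N22_eq_zero_iff (hc hc1) (hc hc2)).2 ⟨rfl, rfl⟩
    · have e1 := potential_add ν μ hNMN (φ 0) (φ 1)
      have e2 := potential_add ν μ hNMN (φ 2) (φ 3)
      rw [homologicalOp_N22_apply]
      funext i
      fin_cases i
      · simpa [ν, μ, hbdef] using e1
      · simp
      · simpa [ν, μ, hbdef'] using e2
      · simp

/-! ### Formal maps in normal form -/

section NormalForm

lemma homogeneousPart_eq_polyPullback_iff {n : ℕ} (A : Matrix (Fin n) (Fin n) ℝ) (f : FormalMap n)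
    (d : ℕ) (i j : Fin n) :
    homogeneousPart d f i = polyPullback A (homogeneousPart d f j) ↔
      ∀ k : Fin n →₀ ℕ, k.degree = d → coeff k (f i) = coeff k (pullback A (f j)) := by
  have key : ∀ k : Fin n →₀ ℕ, k.degree = d →
      MvPolynomial.coeff k (polyPullback A (homogeneousPart d f j)) =
        coeff k (pullback A (f j)) := fun k hk => by
    rw [← MvPolynomial.coeff_coe, coe_polyPullback]
    refine coeff_pullback_congr A fun l hl => ?_
    rw [MvPolynomial.coeff_coe, coeff_homogeneousPart, if_pos (hl.trans hk)]
  constructor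
  · intro h k hk
    rw [← key k hk, ← h, coeff_homogeneousPart, if_pos hk]
  · intro h
    ext k
    by_cases hk : k.degree = d
    · rw [key k hk, coeff_homogeneousPart, if_pos hk, h k hk]
    · have hom : (homogeneousPart d f j).IsHomogeneous d :=
        MvPolynomial.homogeneousComponent_isHomogeneous _ _
      rw [coeff_homogeneousPart, if_neg hk, (isHomogeneous_polyPullback A hom).coeff_eq_zero hk]

/-- The kernel conditions on the homogeneous parts of a formal map assemble to two identities
between formal power series. -/
lemma isInNormalForm_iff {f : FormalMap 4} :
    IsInNormalForm N22 (kerStyle N22) f ↔ OrderGE 2 (f - linearMap N22) ∧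
      (f - linearMap N22) 0 = pullback M22 ((f - linearMap N22) 1) ∧
      (f - linearMap N22) 2 = pullback M22 ((f - linearMap N22) 3) := by
  rw [IsInNormalForm, ← and_assoc, fixesZero_and_jacobian_iff]
  refine and_congr_right fun h2 => ?_
  have hlin : ∀ (i : Fin 4) (k : Fin 4 →₀ ℕ), 2 ≤ k.degree →
      coeff k (f i) = coeff k ((f - linearMap N22) i) := fun i k hk => by
    rw [Pi.sub_apply, map_sub, coeff_linearMap_of_ne _ _ (by omega), sub_zero]
  have hpart : ∀ i j, (∀ k : ℕ, 1 ≤ k →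
      homogeneousPart (k + 1) f i = polyPullback M22 (homogeneousPart (k + 1) f j)) ↔
      (f - linearMap N22) i = pullback M22 ((f - linearMap N22) j) := by
    intro i j
    simp only [homogeneousPart_eq_polyPullback_iff]
    constructor
    · intro h
      ext d
      by_cases hd : d.degree < 2
      · rw [orderGE_iff.1 h2 i d hd, le_order_iff.1 (le_order_pullback M22 (h2 j)) d hd]
      · rw [← hlin i d (by omega), h (d.degree - 1) (by omega) d (by omega)]
        exact coeff_pullback_congr _ fun l hl => hlin j l (by omega)
    · intro h k hk d hd
      rw [hlin i d (by omega), h]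
      exact (coeff_pullback_congr _ fun l hl => hlin j l (by omega)).symm
  rw [← hpart, ← hpart, ← forall₂_and]
  refine forall₂_congr fun k hk => ?_
  have hhom : ∀ i, (homogeneousPart (k + 1) f i).IsHomogeneous (k + 1) := fun i =>
    MvPolynomial.homogeneousComponent_isHomogeneous _ _
  have hc : ∀ i, MvPolynomial.constantCoeff (homogeneousPart (k + 1) f i) = 0 := fun i => by
    rw [MvPolynomial.constantCoeff_eq]
    exact (hhom i).coeff_eq_zero (by simp)
  rw [kerStyle, Submodule.mem_inf, LinearMap.mem_ker, deltaBarM_N22_eq_zero_iff (hc 1) (hc 3),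
    and_iff_right]
  simpa [homogeneousMaps, Submodule.mem_pi, MvPolynomial.mem_homogeneousSubmodule] using hhom

end NormalForm

/-! ### Reduction to normal form -/

section Normalization

lemma potential_sub {V : Type*} [AddCommGroup V] [Module ℝ V] (ν μ : V →ₗ[ℝ] V) (p q p' q' : V) :
    potential ν μ (p - p') (q - q') = potential ν μ p q - potential ν μ p' q' := by
  simp only [potential, map_sub]
  module

/-- The unknown of the homological equation of `N22` with right-hand side `r`. -/
noncomputable def generator (r : FormalMap 4) : FormalMap 4 :=
  ![0, potential (pullback N22).toLinearMap (pullback M22).toLinearMap (r 0) (r 1),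
    0, potential (pullback N22).toLinearMap (pullback M22).toLinearMap (r 2) (r 3)]

/-- The component of `r` in the normal form style, complementary to the image of the homological
operator. -/
noncomputable def normalPart (r : FormalMap 4) : FormalMap 4 :=
  ![pullback M22 (r 1 + pullback N22 (generator r 1)), r 1 + pullback N22 (generator r 1),
    pullback M22 (r 3 + pullback N22 (generator r 3)), r 3 + pullback N22 (generator r 3)]

lemma generator_sub (r s : FormalMap 4) : generator (r - s) = generator r - generator s := by
  funext i
  fin_cases i <;> simp [generator, potential_sub]

lemma normalPart_sub (r s : FormalMap 4) : normalPart (r - s) = normalPart r - normalPart s := by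
  funext i
  fin_cases i <;> simp only [normalPart, generator_sub] <;> simp <;> abel

lemma le_order_potential {p q : MvPowerSeries (Fin 4) ℝ} {e : ℕ} (hp : (e : ℕ∞) ≤ p.order)
    (hq : (e : ℕ∞) ≤ q.order) : (e : ℕ∞) ≤
      (potential (pullback N22).toLinearMap (pullback M22).toLinearMap p q).order := by
  have h := le_order_sub hp (le_order_pullback M22 hq)
  exact le_order_sub h ((le_order_pullback M22 (le_order_pullback N22 h)).trans le_order_smul)

lemma OrderGE.generator {e : ℕ} {r : FormalMap 4} (hr : OrderGE e r) :
    OrderGE e (generator r) := by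
  intro i
  fin_cases i
  exacts [orderGE_zero (n := 4) e 0, le_order_potential (hr 0) (hr 1), orderGE_zero (n := 4) e 0,
    le_order_potential (hr 2) (hr 3)]

lemma OrderGE.normalPart {e : ℕ} {r : FormalMap 4} (hr : OrderGE e r) :
    OrderGE e (normalPart r) := by
  have h : ∀ i, (e : ℕ∞) ≤ (r i + pullback N22 (NilpotentMaps.generator r i)).order := fun i =>
    le_order_add (hr i) (le_order_pullback N22 (hr.generator i))
  intro i
  fin_cases i
  exacts [le_order_pullback M22 (h 1), h 1, le_order_pullback M22 (h 3), h 3]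

/-- The homological equation is solved by `generator r` and `normalPart r`. -/
lemma homological_equation {r : FormalMap 4} (hr : OrderGE 1 r) :
    comp (linearMap N22) (generator r) - comp (generator r) (linearMap N22) + normalPart r = r := by
  have hNMN : ∀ p, pullback N22 (pullback M22 (pullback N22 p)) = pullback N22 p := fun p => by
    rw [pullback_pullback, pullback_pullback, N22_mul_M22_mul_N22]
  have e1 := potential_add (pullback N22).toLinearMap (pullback M22).toLinearMap hNMN (r 0) (r 1)
  have e2 := potential_add (pullback N22).toLinearMap (pullback M22).toLinearMap hNMN (r 2) (r 3)
  rw [linearMap_comp _ hr.generator, comp_linearMap]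
  funext i
  simp only [sum_N22, Pi.add_apply, Pi.sub_apply]
  fin_cases i
  · simpa [generator, normalPart] using e1
  · simp [generator, normalPart]
  · simpa [generator, normalPart] using e2
  · simp [generator, normalPart]

lemma linearMap_comp_add {n : ℕ} (A : Matrix (Fin n) (Fin n) ℝ) {a b : FormalMap n}
    (ha : OrderGE 1 a) (hb : OrderGE 1 b) :
    comp (linearMap A) (a + b) = comp (linearMap A) a + comp (linearMap A) b := by
  rw [linearMap_comp _ (ha.add hb), linearMap_comp _ ha, linearMap_comp _ hb]
  funext i
  simp [smul_add, Finset.sum_add_distrib]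

/-- Every formal map with linear part `N22` is intertwined with a map in normal form by a near
identity map. Writing `f = N + w`, `φ = id + u` and `g = N + v`, the equation `φ ∘ f = g ∘ φ` is
the homological equation for `(u, v)` with right-hand side
`r = w + (u ∘ f - u ∘ N) - (v ∘ φ - v)`, and with `u = generator r`, `v = normalPart r` this is a
contractive fixed point equation for `r`. -/
theorem exists_intertwining {f : FormalMap 4} (hf : OrderGE 2 (f - linearMap N22)) :
    ∃ φ g : FormalMap 4, NearIdentity φ ∧ IsInNormalForm N22 (kerStyle N22) g ∧
      comp φ f = comp g φ := by
  have hN : OrderGE 1 (linearMap N22) := orderGE_linearMap N22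
  have hf1 : OrderGE 1 f := hN.one_of_sub hf
  have hid : ∀ {s : FormalMap 4}, OrderGE 2 s → OrderGE 1 (idMap 4 + s) := fun hs =>
    orderGE_idMap.add (hs.mono one_le_two)
  let T : FormalMap 4 → FormalMap 4 := fun r => f - linearMap N22 +
    (comp (generator r) f - comp (generator r) (linearMap N22)) -
    (comp (normalPart r) (idMap 4 + generator r) - normalPart r)
  have hT : ∀ r, OrderGE 2 r → OrderGE 2 (T r) := fun r hr =>
    (hf.add ((hr.generator.comp hf1).sub (hr.generator.comp hN))).sub
      ((hr.normalPart.comp (hid hr.generator)).sub hr.normalPart)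
  obtain ⟨r, hr, hfix⟩ := exists_fixedPoint (c := 2) T hT fun a b e ha hb hab => by
    -- a series of order `m + 1` is needed for the gain of `m` orders in `OrderGE.comp_sub_comp`
    obtain _ | m := e
    · exact ((hT a ha).sub (hT b hb)).mono one_le_two
    have hu := hab.generator
    have hv := hab.normalPart
    rw [generator_sub] at hu
    rw [normalPart_sub] at hv
    have h1 := hu.comp_sub_comp hf1 hN hf
    have h2 := hv.comp_sub_comp (e := 2) (hid ha.generator) orderGE_idMap
      (by simpa using ha.generator)
    have h3 := (hb.normalPart).comp_sub_comp (m := 1) (hid ha.generator) (hid hb.generator)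
      (by simpa [add_sub_add_left_eq_sub] using hu)
    rw [comp_sub hf1, comp_sub hN] at h1
    rw [comp_sub (hid ha.generator), comp_idMap] at h2
    rw [add_comm 1] at h3
    have key := (h1.sub h2).sub h3
    refine (congrArg (OrderGE (m + 2)) ?_).mp key
    simp only [T]
    abel
  have hu := hr.generator
  have hv := hr.normalPart
  have hφ := hid hu
  refine ⟨idMap 4 + generator r, linearMap N22 + normalPart r,
    nearIdentity_iff.2 (by simpa using hu), isInNormalForm_iff.2 ?_, ?_⟩
  · rw [add_sub_cancel_left]
    exact ⟨hv, rfl, rfl⟩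
  · have hom := homological_equation (hr.mono one_le_two)
    rw [comp_add hf1, idMap_comp hf1, comp_add hφ,
      linearMap_comp_add _ orderGE_idMap (hu.mono one_le_two), comp_idMap]
    have h := hom.trans hfix.symm
    simp only [T] at h
    rw [← sub_eq_zero] at h ⊢
    rw [← neg_eq_zero, ← h]
    abel

/-- Every formal map with linear part `N22` is conjugate to one in normal form. -/
theorem exists_conjugate_isInNormalForm {f : FormalMap 4} (h0 : FixesZero f)
    (h1 : jacobianAtZero f = N22) :
    ∃ φ ψ : FormalMap 4, NearIdentity φ ∧ NearIdentity ψ ∧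
      comp φ ψ = idMap 4 ∧ comp ψ φ = idMap 4 ∧
      IsInNormalForm N22 (kerStyle N22) (comp φ (comp f ψ)) := by
  obtain ⟨φ, g, hφ, hg, h⟩ := exists_intertwining (fixesZero_and_jacobian_iff.1 ⟨h0, h1⟩)
  obtain ⟨ψ, hψ, h2, h3⟩ := hφ.exists_inverse
  refine ⟨φ, ψ, hφ, hψ, h2, h3, ?_⟩
  rwa [← comp_assoc (fixesZero_iff_orderGE.1 h0) hψ.orderGE, h,
    comp_assoc hφ.orderGE hψ.orderGE, h2, comp_idMap]

end Normalization

/-! ### Coefficients of the explicit families -/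

section Coefficients

variable {m n : ℕ}

/-- The coefficient of a power series in finitely many variables at the exponent vector `v`. -/
noncomputable def coeffAt (v : Fin m → ℕ) (f : MvPowerSeries (Fin m) ℝ) : ℝ :=
  coeff (Finsupp.equivFunOnFinite.symm v) f

lemma coeffAt_ext {f g : MvPowerSeries (Fin m) ℝ} (h : ∀ v, coeffAt v f = coeffAt v g) :
    f = g := by
  ext d
  simpa [coeffAt] using h d

lemma coeff_eq_coeffAt (d : Fin m →₀ ℕ) (f : MvPowerSeries (Fin m) ℝ) :
    coeff d f = coeffAt d f := by simp [coeffAt]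

lemma coeffAt_add (v : Fin m → ℕ) (f g : MvPowerSeries (Fin m) ℝ) :
    coeffAt v (f + g) = coeffAt v f + coeffAt v g := rfl

lemma coeffAt_X_mul (v : Fin m → ℕ) (i : Fin m) (f : MvPowerSeries (Fin m) ℝ) :
    coeffAt v (X i * f) = if v i = 0 then 0 else coeffAt (Function.update v i (v i - 1)) f := by
  classical
  rw [coeffAt, X, coeff_monomial_mul, one_mul]
  have hle : Finsupp.single i 1 ≤ Finsupp.equivFunOnFinite.symm v ↔ v i ≠ 0 := by
    rw [Finsupp.single_le_iff]
    simp [Nat.one_le_iff_ne_zero]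
  by_cases h : v i = 0
  · rw [if_neg (by rw [hle]; simpa using h), if_pos h]
  · rw [if_pos (hle.2 h), if_neg h, coeffAt]
    have hv : Finsupp.equivFunOnFinite.symm v - Finsupp.single i 1 =
        Finsupp.equivFunOnFinite.symm (Function.update v i (v i - 1)) := by
      ext j
      by_cases hj : j = i
      · subst hj; simp
      · simp [hj]
    rw [hv]

lemma coeffAt_subst_X (e : Fin m → Fin n) (he : Function.Injective e) (v : Fin n → ℕ)
    (q : MvPowerSeries (Fin m) ℝ) :
    coeffAt v (subst (fun i => (X (e i) : MvPowerSeries (Fin n) ℝ)) q) =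
      if ∀ j, (∀ i, e i ≠ j) → v j = 0 then coeffAt (v ∘ e) q else 0 := by
  have hren : subst (fun i => (X (e i) : MvPowerSeries (Fin n) ℝ)) q =
      rename (⟨e, he⟩ : Fin m ↪ Fin n) q := (rename_eq_subst _ _).symm
  rw [hren]
  split_ifs with h
  · have hv : Finsupp.equivFunOnFinite.symm v =
        Finsupp.embDomain ⟨e, he⟩ (Finsupp.equivFunOnFinite.symm (v ∘ e)) := by
      ext j
      by_cases hj : ∃ i, e i = j
      · obtain ⟨i, rfl⟩ := hj
        exact (Finsupp.embDomain_apply_self (⟨e, he⟩ : Fin m ↪ Fin n)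
          (Finsupp.equivFunOnFinite.symm (v ∘ e)) i).symm
      · rw [Finsupp.embDomain_of_notMem_range _ _ _ (by simpa using hj)]
        exact h j (by simpa using hj)
    rw [coeffAt, hv, coeff_embDomain_rename, coeffAt]
  · refine coeff_rename_eq_zero _ _ ?_
    rintro ⟨d, hd⟩
    refine h fun j hj => ?_
    have := DFunLike.congr_fun hd j
    rw [Finsupp.mapDomain_of_notMem_range _ _ (by simpa using hj)] at this
    exact this.symm

/-- A power series whose coefficients are among those of a polynomial, each used at most once,
is a polynomial. -/
lemma exists_polynomial_of_coeff {F : MvPowerSeries (Fin m) ℝ} {p : MvPolynomial (Fin n) ℝ}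
    (ι : (Fin m → ℕ) → Fin n → ℕ) (hι : Function.Injective ι)
    (h : ∀ v, coeffAt v F = coeffAt (ι v) (p : MvPowerSeries (Fin n) ℝ)) :
    ∃ q : MvPolynomial (Fin m) ℝ, (q : MvPowerSeries (Fin m) ℝ) = F := by
  have hinj : Function.Injective fun d : Fin m →₀ ℕ => Finsupp.equivFunOnFinite.symm (ι d) :=
    Finsupp.equivFunOnFinite.symm.injective.comp (hι.comp DFunLike.coe_injective)
  refine ⟨∑ d ∈ p.support.preimage _ hinj.injOn, MvPolynomial.monomial d (coeff d F), ?_⟩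
  ext d
  classical
  simp only [MvPolynomial.coeff_coe, MvPolynomial.coeff_sum, MvPolynomial.coeff_monomial,
    Finset.sum_ite_eq']
  split_ifs with hd
  · rfl
  · rw [Finset.mem_preimage, MvPolynomial.notMem_support_iff] at hd
    rw [coeff_eq_coeffAt, h, coeffAt, MvPolynomial.coeff_coe, hd]

end Coefficients

section Families

/-- Evaluation of a power series at power series. -/
noncomputable abbrev seriesEv {m : ℕ} (q : Series m) (v : Fin m → MvPowerSeries (Fin 4) ℝ) :
    MvPowerSeries (Fin 4) ℝ := subst v q

/-- The second component of a block, with formal power series as families. -/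
noncomputable abbrev lowerSeries (F : Families Series) : MvPowerSeries (Fin 4) ℝ :=
  lowerComponent (P := Series) seriesEv (X 0) (X 1) (X 2) (X 3) F

/-- The first component of a block, with formal power series as families. -/
noncomputable abbrev upperSeries (F : Families Series) : MvPowerSeries (Fin 4) ℝ :=
  upperComponent (P := Series) seriesEv (X 0) (X 2) F

variable (a b c d : ℕ)

lemma coeffAt_X0_mul (f : MvPowerSeries (Fin 4) ℝ) :
    coeffAt ![a, b, c, d] (X 0 * f) = if a = 0 then 0 else coeffAt ![a - 1, b, c, d] f := by
  rw [coeffAt_X_mul]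
  congr 2
  funext i
  fin_cases i <;> rfl

lemma coeffAt_X1_mul (f : MvPowerSeries (Fin 4) ℝ) :
    coeffAt ![a, b, c, d] (X 1 * f) = if b = 0 then 0 else coeffAt ![a, b - 1, c, d] f := by
  rw [coeffAt_X_mul]
  congr 2
  funext i
  fin_cases i <;> rfl

lemma coeffAt_X2_mul (f : MvPowerSeries (Fin 4) ℝ) :
    coeffAt ![a, b, c, d] (X 2 * f) = if c = 0 then 0 else coeffAt ![a, b, c - 1, d] f := by
  rw [coeffAt_X_mul]
  congr 2
  funext i
  fin_cases i <;> rfl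

lemma coeffAt_X3_mul (f : MvPowerSeries (Fin 4) ℝ) :
    coeffAt ![a, b, c, d] (X 3 * f) = if d = 0 then 0 else coeffAt ![a, b, c, d - 1] f := by
  rw [coeffAt_X_mul]
  congr 2
  funext i
  fin_cases i <;> rfl

lemma coeffAt_subst_X0123 (q : Series 4) :
    coeffAt ![a, b, c, d] (subst ![X 0, X 1, X 2, X 3] q : MvPowerSeries (Fin 4) ℝ) =
      coeffAt ![a, b, c, d] q := by
  have hw : (![X 0, X 1, X 2, X 3] : Fin 4 → MvPowerSeries (Fin 4) ℝ) = X := by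
    funext i; fin_cases i <;> rfl
  rw [hw, subst_self, id]

lemma coeffAt_subst_X023 (q : Series 3) :
    coeffAt ![a, b, c, d] (subst ![X 0, X 2, X 3] q : MvPowerSeries (Fin 4) ℝ) =
      if b = 0 then coeffAt ![a, c, d] q else 0 := by
  have hw : (![X 0, X 2, X 3] : Fin 3 → MvPowerSeries (Fin 4) ℝ) = fun i => X (![0, 2, 3] i) := by
    funext i; fin_cases i <;> rfl
  have hv : ![a, b, c, d] ∘ ![0, 2, 3] = ![a, c, d] := by funext i; fin_cases i <;> rfl
  rw [hw, coeffAt_subst_X _ (by decide), hv]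
  simp [Fin.forall_fin_succ]

lemma coeffAt_subst_X123 (q : Series 3) :
    coeffAt ![a, b, c, d] (subst ![X 1, X 2, X 3] q : MvPowerSeries (Fin 4) ℝ) =
      if a = 0 then coeffAt ![b, c, d] q else 0 := by
  have hw : (![X 1, X 2, X 3] : Fin 3 → MvPowerSeries (Fin 4) ℝ) = fun i => X (![1, 2, 3] i) := by
    funext i; fin_cases i <;> rfl
  have hv : ![a, b, c, d] ∘ ![1, 2, 3] = ![b, c, d] := by funext i; fin_cases i <;> rfl
  rw [hw, coeffAt_subst_X _ (by decide), hv]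
  simp [Fin.forall_fin_succ]

lemma coeffAt_subst_X23 (q : Series 2) :
    coeffAt ![a, b, c, d] (subst ![X 2, X 3] q : MvPowerSeries (Fin 4) ℝ) =
      if a = 0 ∧ b = 0 then coeffAt ![c, d] q else 0 := by
  have hw : (![X 2, X 3] : Fin 2 → MvPowerSeries (Fin 4) ℝ) = fun i => X (![2, 3] i) := by
    funext i; fin_cases i <;> rfl
  have hv : ![a, b, c, d] ∘ ![2, 3] = ![c, d] := by funext i; fin_cases i <;> rfl
  rw [hw, coeffAt_subst_X _ (by decide), hv]
  simp [Fin.forall_fin_succ]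

lemma coeffAt_subst_X02 (q : Series 2) :
    coeffAt ![a, b, c, d] (subst ![X 0, X 2] q : MvPowerSeries (Fin 4) ℝ) =
      if b = 0 ∧ d = 0 then coeffAt ![a, c] q else 0 := by
  have hw : (![X 0, X 2] : Fin 2 → MvPowerSeries (Fin 4) ℝ) = fun i => X (![0, 2] i) := by
    funext i; fin_cases i <;> rfl
  have hv : ![a, b, c, d] ∘ ![0, 2] = ![a, c] := by funext i; fin_cases i <;> rfl
  rw [hw, coeffAt_subst_X _ (by decide), hv]
  simp [Fin.forall_fin_succ]

lemma coeffAt_subst_X13 (q : Series 2) :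
    coeffAt ![a, b, c, d] (subst ![X 1, X 3] q : MvPowerSeries (Fin 4) ℝ) =
      if a = 0 ∧ c = 0 then coeffAt ![b, d] q else 0 := by
  have hw : (![X 1, X 3] : Fin 2 → MvPowerSeries (Fin 4) ℝ) = fun i => X (![1, 3] i) := by
    funext i; fin_cases i <;> rfl
  have hv : ![a, b, c, d] ∘ ![1, 3] = ![b, d] := by funext i; fin_cases i <;> rfl
  rw [hw, coeffAt_subst_X _ (by decide), hv]
  simp [Fin.forall_fin_succ]

lemma coeffAt_subst_X2 (q : Series 1) :
    coeffAt ![a, b, c, d] (subst ![X 2] q : MvPowerSeries (Fin 4) ℝ) =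
      if a = 0 ∧ b = 0 ∧ d = 0 then coeffAt ![c] q else 0 := by
  have hw : (![X 2] : Fin 1 → MvPowerSeries (Fin 4) ℝ) = fun i => X (![2] i) := by
    funext i; fin_cases i; rfl
  have hv : ![a, b, c, d] ∘ ![2] = ![c] := by funext i; fin_cases i; rfl
  rw [hw, coeffAt_subst_X _ (by decide), hv]
  simp [Fin.forall_fin_succ]

lemma coeffAt_subst_X3 (q : Series 1) :
    coeffAt ![a, b, c, d] (subst ![X 3] q : MvPowerSeries (Fin 4) ℝ) =
      if a = 0 ∧ b = 0 ∧ c = 0 then coeffAt ![d] q else 0 := by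
  have hw : (![X 3] : Fin 1 → MvPowerSeries (Fin 4) ℝ) = fun i => X (![3] i) := by
    funext i; fin_cases i; rfl
  have hv : ![a, b, c, d] ∘ ![3] = ![d] := by funext i; fin_cases i; rfl
  rw [hw, coeffAt_subst_X _ (by decide), hv]
  simp [Fin.forall_fin_succ]

/-- The eight families of a block read off the coefficients of the second component: the
monomials of positive degree are distributed among the terms according to which of the four
variables occur in them. -/
lemma coeffAt_lowerSeries (F : Families Series) : coeffAt ![a, b, c, d] (lowerSeries F) =
    match a, b, c, d with
    | a + 1, b + 1, c, d => coeffAt ![a, b, c, d] F.F12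
    | a + 1, 0, c, d + 1 => coeffAt ![a, c, d] F.F14
    | a + 1, 0, c, 0 => coeffAt ![a, c] F.F10
    | 0, b + 1, c + 1, d => coeffAt ![b, c, d] F.F23
    | 0, b + 1, 0, d => coeffAt ![b, d] F.F11
    | 0, 0, c + 1, d + 1 => coeffAt ![c, d] F.F34
    | 0, 0, c + 1, 0 => coeffAt ![c] F.F30
    | 0, 0, 0, d + 1 => coeffAt ![d] F.F31
    | 0, 0, 0, 0 => 0 := by
  simp only [lowerSeries, lowerComponent, seriesEv, mul_assoc, coeffAt_add, coeffAt_X0_mul,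
    coeffAt_X1_mul, coeffAt_X2_mul, coeffAt_X3_mul, coeffAt_subst_X0123, coeffAt_subst_X023,
    coeffAt_subst_X123, coeffAt_subst_X23, coeffAt_subst_X02, coeffAt_subst_X13,
    coeffAt_subst_X2, coeffAt_subst_X3]
  rcases a with _ | a <;> rcases b with _ | b <;> rcases c with _ | c <;> rcases d with _ | d <;>
    simp

lemma eq_vecCons_four (v : Fin 4 → ℕ) : v = ![v 0, v 1, v 2, v 3] := by
  funext i; fin_cases i <;> rfl

end Families

/-! ### The explicit form of the kernel -/

section ExplicitForm

lemma lowerSeries_injective : Function.Injective lowerSeries := by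
  intro F F' h
  have key : ∀ a b c d, coeffAt ![a, b, c, d] (lowerSeries F) =
      coeffAt ![a, b, c, d] (lowerSeries F') := fun a b c d => by rw [h]
  simp only [coeffAt_lowerSeries] at key
  have e4 : ∀ v : Fin 4 → ℕ, v = ![v 0, v 1, v 2, v 3] := eq_vecCons_four
  have e3 : ∀ v : Fin 3 → ℕ, v = ![v 0, v 1, v 2] := fun v => by
    funext i; fin_cases i <;> rfl
  have e2 : ∀ v : Fin 2 → ℕ, v = ![v 0, v 1] := fun v => by
    funext i; fin_cases i <;> rfl
  have e1 : ∀ v : Fin 1 → ℕ, v = ![v 0] := fun v => by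
    funext i; fin_cases i; rfl
  obtain ⟨F12, F14, F23, F34, F10, F11, F30, F31⟩ := F
  obtain ⟨G12, G14, G23, G34, G10, G11, G30, G31⟩ := F'
  rw [Families.mk.injEq]
  refine ⟨coeffAt_ext fun v => ?_, coeffAt_ext fun v => ?_, coeffAt_ext fun v => ?_,
    coeffAt_ext fun v => ?_, coeffAt_ext fun v => ?_, coeffAt_ext fun v => ?_,
    coeffAt_ext fun v => ?_, coeffAt_ext fun v => ?_⟩
  · rw [e4 v]; exact key (v 0 + 1) (v 1 + 1) (v 2) (v 3)
  · rw [e3 v]; exact key (v 0 + 1) 0 (v 1) (v 2 + 1)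
  · rw [e3 v]; exact key 0 (v 0 + 1) (v 1 + 1) (v 2)
  · rw [e2 v]; exact key 0 0 (v 0 + 1) (v 1 + 1)
  · rw [e2 v]; exact key (v 0 + 1) 0 (v 1) 0
  · rw [e2 v]; exact key 0 (v 0 + 1) 0 (v 1)
  · rw [e1 v]; exact key 0 0 (v 0 + 1) 0
  · rw [e1 v]; exact key 0 0 0 (v 0 + 1)

/-- The families whose second component is the given series without constant term. -/
noncomputable def familiesOf (p : MvPowerSeries (Fin 4) ℝ) : Families Series where
  F12 := fun v => coeffAt ![v 0 + 1, v 1 + 1, v 2, v 3] p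
  F14 := fun v => coeffAt ![v 0 + 1, 0, v 1, v 2 + 1] p
  F23 := fun v => coeffAt ![0, v 0 + 1, v 1 + 1, v 2] p
  F34 := fun v => coeffAt ![0, 0, v 0 + 1, v 1 + 1] p
  F10 := fun v => coeffAt ![v 0 + 1, 0, v 1, 0] p
  F11 := fun v => coeffAt ![0, v 0 + 1, 0, v 1] p
  F30 := fun v => coeffAt ![0, 0, v 0 + 1, 0] p
  F31 := fun v => coeffAt ![0, 0, 0, v 0 + 1] p

lemma lowerSeries_familiesOf {p : MvPowerSeries (Fin 4) ℝ} (hp : constantCoeff p = 0) :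
    lowerSeries (familiesOf p) = p := by
  refine coeffAt_ext fun v => ?_
  rw [eq_vecCons_four v, coeffAt_lowerSeries]
  have h0 : coeffAt ![0, 0, 0, 0] p = 0 := by
    have : Finsupp.equivFunOnFinite.symm ![0, 0, 0, 0] = (0 : Fin 4 →₀ ℕ) := by
      ext i; fin_cases i <;> rfl
    rw [coeffAt, this]
    exact hp
  generalize v 0 = a, v 1 = b, v 2 = c, v 3 = d
  rcases a with _ | a <;> rcases b with _ | b <;> rcases c with _ | c <;> rcases d with _ | d <;>
    first | exact h0.symm | rfl

lemma constantCoeff_lowerSeries (F : Families Series) : constantCoeff (lowerSeries F) = 0 := by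
  have : constantCoeff (lowerSeries F) = coeffAt ![0, 0, 0, 0] (lowerSeries F) := by
    rw [coeffAt, ← coeff_zero_eq_constantCoeff_apply]
    congr 2
    ext i; fin_cases i <;> rfl
  rw [this, coeffAt_lowerSeries]

/-- Substituting `M x = (0, x₁, 0, x₃)` into the second component of a block leaves the terms in
`x₂` and `x₄` alone, and turns them into the first component. -/
lemma pullback_lowerSeries (F : Families Series) :
    pullback M22 (lowerSeries F) = upperSeries F := by
  have hsub : ∀ {m : ℕ} (v : Fin m → MvPowerSeries (Fin 4) ℝ) (q : Series m),
      (∀ i, constantCoeff (v i) = 0) →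
      pullback M22 (subst v q) = subst (fun i => pullback M22 (v i)) q := fun v q hv => by
    simp only [pullback_apply]
    exact subst_comp_subst_apply (hasSubst_of_constantCoeff_zero hv)
      (orderGE_linearMap M22).hasSubst q
  have h13 : pullback M22 (subst ![X 1, X 3] F.F11) =
      (subst ![X 0, X 2] F.F11 : MvPowerSeries (Fin 4) ℝ) := by
    rw [hsub _ _ (fun i => by fin_cases i <;> simp)]
    congr 1
    funext i
    fin_cases i <;> simp [pullback_X, linearMap_M22]
  have h3 : pullback M22 (subst ![X 3] F.F31) =
      (subst ![X 2] F.F31 : MvPowerSeries (Fin 4) ℝ) := by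
    rw [hsub _ _ (fun i => by fin_cases i; simp)]
    congr 1
    funext i
    fin_cases i
    simp [pullback_X, linearMap_M22]
  simp only [lowerSeries, upperSeries, lowerComponent, upperComponent, seriesEv, map_add, map_mul,
    h13, h3]
  simp [pullback_X, linearMap_M22]

lemma formalTerms_eq_pullback (FG : Families Series × Families Series) : formalTerms FG =
    ![pullback M22 (lowerSeries FG.1), lowerSeries FG.1,
      pullback M22 (lowerSeries FG.2), lowerSeries FG.2] := by
  rw [pullback_lowerSeries, pullback_lowerSeries]
  rfl

lemma formalTerms_injective : Function.Injective formalTerms := by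
  intro FG FG' h
  exact Prod.ext (lowerSeries_injective (congrFun h 1)) (lowerSeries_injective (congrFun h 3))

lemma formalTerms_familiesOf {g : FormalMap 4} (h1 : constantCoeff (g 1) = 0)
    (h3 : constantCoeff (g 3) = 0) (h0 : g 0 = pullback M22 (g 1)) (h2 : g 2 = pullback M22 (g 3)) :
    formalTerms (familiesOf (g 1), familiesOf (g 3)) = g := by
  rw [formalTerms_eq_pullback, lowerSeries_familiesOf h1, lowerSeries_familiesOf h3, ← h0, ← h2]
  funext i
  fin_cases i <;> rfl

/-- The linear coefficients of the second component are the constant terms of four families. -/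
lemma noLinearTerms_iff {F : Families Series} :
    F.NoLinearTerms ↔ 2 ≤ (lowerSeries F).order := by
  have hc : ∀ {m : ℕ} (q : Series m), constantCoeff q = coeffAt 0 q := fun q => by
    rw [← coeff_zero_eq_constantCoeff_apply, coeff_eq_coeffAt]
    rfl
  have hz2 : (0 : Fin 2 → ℕ) = ![0, 0] := by funext i; fin_cases i <;> rfl
  have hz1 : (0 : Fin 1 → ℕ) = ![0] := by funext i; fin_cases i; rfl
  have key : F.NoLinearTerms ↔ ∀ i, coeff (Finsupp.single i 1) (lowerSeries F) = 0 := by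
    have hs : ∀ i, coeff (Finsupp.single i 1) (lowerSeries F) =
        coeffAt (Pi.single i 1) (lowerSeries F) := fun i => by
      rw [coeff_eq_coeffAt, Finsupp.single_eq_pi_single]
    have h0 : (Pi.single 0 1 : Fin 4 → ℕ) = ![1, 0, 0, 0] := by decide
    have h1 : (Pi.single 1 1 : Fin 4 → ℕ) = ![0, 1, 0, 0] := by decide
    have h2 : (Pi.single 2 1 : Fin 4 → ℕ) = ![0, 0, 1, 0] := by decide
    have h3 : (Pi.single 3 1 : Fin 4 → ℕ) = ![0, 0, 0, 1] := by decide
    simp only [Fin.forall_fin_succ, hs, Families.NoLinearTerms, hc, hz1,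
      hz2]
    simp [h0, h1, h2, h3, coeffAt_lowerSeries]
  rw [key, show (2 : ℕ∞) = ((2 : ℕ) : ℕ∞) from rfl, le_order_iff]
  constructor
  · intro h d hd
    obtain hd | hd : d.degree = 0 ∨ d.degree = 1 := by omega
    · rw [(Finsupp.degree_eq_zero_iff d).1 hd]
      exact constantCoeff_lowerSeries F
    · obtain ⟨j, rfl⟩ : d ∈ Set.range fun j : Fin 4 => Finsupp.single j 1 := by
        rw [Finsupp.range_single_one]
        exact hd
      exact h j
  · intro h i
    exact h _ (by simp [Finsupp.degree_single])

lemma orderGE_formalTerms_iff (FG : Families Series × Families Series) :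
    OrderGE 2 (formalTerms FG) ↔ FG.1.NoLinearTerms ∧ FG.2.NoLinearTerms := by
  rw [noLinearTerms_iff, noLinearTerms_iff, formalTerms_eq_pullback]
  constructor
  · exact fun h => ⟨h 1, h 3⟩
  · rintro ⟨h1, h3⟩ i
    fin_cases i
    exacts [le_order_pullback M22 h1, h1, le_order_pullback M22 h3, h3]

theorem isInNormalForm_iff_existsUnique (f : FormalMap 4) :
    IsInNormalForm N22 (kerStyle N22) f ↔ ∃! FG : Families Series × Families Series,
      FG.1.NoLinearTerms ∧ FG.2.NoLinearTerms ∧ f = linearMap N22 + formalTerms FG := by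
  simp only [← and_assoc, ← orderGE_formalTerms_iff]
  rw [isInNormalForm_iff]
  constructor
  · rintro ⟨h, h0, h2⟩
    have hc := fixesZero_iff_orderGE.2 (h.mono one_le_two)
    have hg := formalTerms_familiesOf (hc 1) (hc 3) h0 h2
    refine ⟨_, ⟨by rwa [hg], by rw [hg, add_sub_cancel]⟩, ?_⟩
    rintro FG ⟨-, rfl⟩
    refine formalTerms_injective ?_
    rw [hg, add_sub_cancel_left]
  · rintro ⟨FG, ⟨h, rfl⟩, -⟩
    rw [add_sub_cancel_left]
    refine ⟨h, ?_, ?_⟩ <;> simp [formalTerms_eq_pullback]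

/-- Polynomial families viewed as families of formal power series. -/
noncomputable def Families.toSeries (F : Families Poly) : Families Series where
  F12 := MvPolynomial.toMvPowerSeries F.F12
  F14 := MvPolynomial.toMvPowerSeries F.F14
  F23 := MvPolynomial.toMvPowerSeries F.F23
  F34 := MvPolynomial.toMvPowerSeries F.F34
  F10 := MvPolynomial.toMvPowerSeries F.F10
  F11 := MvPolynomial.toMvPowerSeries F.F11
  F30 := MvPolynomial.toMvPowerSeries F.F30
  F31 := MvPolynomial.toMvPowerSeries F.F31

lemma Families.toSeries_injective : Function.Injective Families.toSeries := by
  rintro ⟨F12, F14, F23, F34, F10, F11, F30, F31⟩ ⟨G12, G14, G23, G34, G10, G11, G30, G31⟩ h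
  simpa [Families.toSeries] using h

lemma coe_polyTerms (FG : Families Poly × Families Poly) (i : Fin 4) :
    (polyTerms FG i : MvPowerSeries (Fin 4) ℝ) =
      formalTerms (FG.1.toSeries, FG.2.toSeries) i := by
  have v1 : ∀ p : MvPolynomial (Fin 4) ℝ, (fun i => (![p] i : MvPowerSeries (Fin 4) ℝ)) =
      ![(p : MvPowerSeries (Fin 4) ℝ)] := fun p => by
    funext i; fin_cases i; rfl
  have v2 : ∀ p q : MvPolynomial (Fin 4) ℝ, (fun i => (![p, q] i : MvPowerSeries (Fin 4) ℝ)) =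
      ![(p : MvPowerSeries (Fin 4) ℝ), q] := fun p q => by
    funext i; fin_cases i <;> rfl
  have v3 : ∀ p q r : MvPolynomial (Fin 4) ℝ,
      (fun i => (![p, q, r] i : MvPowerSeries (Fin 4) ℝ)) =
        ![(p : MvPowerSeries (Fin 4) ℝ), q, r] := fun p q r => by
    funext i; fin_cases i <;> rfl
  have v4 : ∀ p q r s : MvPolynomial (Fin 4) ℝ,
      (fun i => (![p, q, r, s] i : MvPowerSeries (Fin 4) ℝ)) =
        ![(p : MvPowerSeries (Fin 4) ℝ), q, r, s] := fun p q r s => by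
    funext i; fin_cases i <;> rfl
  have upper : ∀ F : Families Poly,
      ((upperComponent (P := Poly) (fun q v => MvPolynomial.aeval v q) (MvPolynomial.X 0)
        (MvPolynomial.X 2) F : MvPolynomial (Fin 4) ℝ) : MvPowerSeries (Fin 4) ℝ) =
        upperSeries F.toSeries := fun F => by
    simp only [upperSeries, upperComponent, seriesEv, Families.toSeries, MvPolynomial.coe_add,
      MvPolynomial.coe_mul, MvPolynomial.coe_X, coe_aeval, v1, v2]
  have lower : ∀ F : Families Poly,
      ((lowerComponent (P := Poly) (fun q v => MvPolynomial.aeval v q) (MvPolynomial.X 0)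
        (MvPolynomial.X 1) (MvPolynomial.X 2) (MvPolynomial.X 3) F : MvPolynomial (Fin 4) ℝ) :
        MvPowerSeries (Fin 4) ℝ) = lowerSeries F.toSeries := fun F => by
    simp only [lowerSeries, lowerComponent, seriesEv, Families.toSeries, MvPolynomial.coe_add,
      MvPolynomial.coe_mul, MvPolynomial.coe_X, coe_aeval, v1, v2, v3, v4]
  fin_cases i
  exacts [upper FG.1, lower FG.1, upper FG.2, lower FG.2]

theorem polyTerms_injective : Function.Injective polyTerms := by
  intro FG FG' h
  have : formalTerms (FG.1.toSeries, FG.2.toSeries) =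
      formalTerms (FG'.1.toSeries, FG'.2.toSeries) := by
    funext i
    rw [← coe_polyTerms, ← coe_polyTerms, h]
  have h2 := formalTerms_injective this
  exact Prod.ext (Families.toSeries_injective (congrArg Prod.fst h2))
    (Families.toSeries_injective (congrArg Prod.snd h2))

lemma exists_toSeries_eq_familiesOf (p : MvPolynomial (Fin 4) ℝ) :
    ∃ F : Families Poly, F.toSeries = familiesOf (p : MvPowerSeries (Fin 4) ℝ) := by
  have inj : ∀ {m : ℕ} (ι : (Fin m → ℕ) → Fin 4 → ℕ),
      (∀ v w, ι v = ι w → ∀ i, v i = w i) → Function.Injective ι :=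
    fun ι h v w hvw => funext (h v w hvw)
  obtain ⟨F12, h12⟩ := exists_polynomial_of_coeff (p := p) (F := (familiesOf p).F12)
    (fun v => ![v 0 + 1, v 1 + 1, v 2, v 3])
    (inj _ fun v w h => by simpa [Fin.forall_fin_succ] using h) fun v => rfl
  obtain ⟨F14, h14⟩ := exists_polynomial_of_coeff (p := p) (F := (familiesOf p).F14)
    (fun v => ![v 0 + 1, 0, v 1, v 2 + 1])
    (inj _ fun v w h => by simpa [Fin.forall_fin_succ] using h) fun v => rfl
  obtain ⟨F23, h23⟩ := exists_polynomial_of_coeff (p := p) (F := (familiesOf p).F23)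
    (fun v => ![0, v 0 + 1, v 1 + 1, v 2])
    (inj _ fun v w h => by simpa [Fin.forall_fin_succ] using h) fun v => rfl
  obtain ⟨F34, h34⟩ := exists_polynomial_of_coeff (p := p) (F := (familiesOf p).F34)
    (fun v => ![0, 0, v 0 + 1, v 1 + 1])
    (inj _ fun v w h => by simpa [Fin.forall_fin_succ] using h) fun v => rfl
  obtain ⟨F10, h10⟩ := exists_polynomial_of_coeff (p := p) (F := (familiesOf p).F10)
    (fun v => ![v 0 + 1, 0, v 1, 0])
    (inj _ fun v w h => by simpa [Fin.forall_fin_succ] using h) fun v => rfl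
  obtain ⟨F11, h11⟩ := exists_polynomial_of_coeff (p := p) (F := (familiesOf p).F11)
    (fun v => ![0, v 0 + 1, 0, v 1])
    (inj _ fun v w h => by simpa [Fin.forall_fin_succ] using h) fun v => rfl
  obtain ⟨F30, h30⟩ := exists_polynomial_of_coeff (p := p) (F := (familiesOf p).F30)
    (fun v => ![0, 0, v 0 + 1, 0])
    (inj _ fun v w h => by simpa [Fin.forall_fin_succ] using h) fun v => rfl
  obtain ⟨F31, h31⟩ := exists_polynomial_of_coeff (p := p) (F := (familiesOf p).F31)
    (fun v => ![0, 0, 0, v 0 + 1])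
    (inj _ fun v w h => by simpa [Fin.forall_fin_succ] using h) fun v => rfl
  refine ⟨⟨F12, F14, F23, F34, F10, F11, F30, F31⟩, ?_⟩
  simp only [Families.toSeries, h12, h14, h23, h34, h10, h11, h30, h31]

lemma constantCoeff_coe {m : ℕ} (p : MvPolynomial (Fin m) ℝ) :
    constantCoeff (p : MvPowerSeries (Fin m) ℝ) = MvPolynomial.constantCoeff p := by
  rw [← coeff_zero_eq_constantCoeff_apply, MvPolynomial.coeff_coe, MvPolynomial.constantCoeff_eq]

theorem range_polyTerms : Set.range polyTerms =
    {φ : PolyMap 4 | (∀ i, MvPolynomial.constantCoeff (φ i) = 0) ∧ deltaBarM N22 φ = 0} := by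
  apply Set.Subset.antisymm
  · rintro _ ⟨FG, rfl⟩
    have hL : ∀ F, OrderGE 1 (fun _ : Fin 4 => lowerSeries F) := fun F =>
      fixesZero_iff_orderGE.1 fun _ => constantCoeff_lowerSeries F
    have hc : ∀ i, MvPolynomial.constantCoeff (polyTerms FG i) = 0 := by
      intro i
      rw [← constantCoeff_coe, coe_polyTerms, formalTerms_eq_pullback,
        ← one_le_order_iff_constCoeff_eq_zero]
      fin_cases i
      exacts [mod_cast le_order_pullback M22 (hL _ 0), mod_cast hL _ 0,
        mod_cast le_order_pullback M22 (hL _ 0), mod_cast hL _ 0]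
    refine ⟨hc, (deltaBarM_N22_eq_zero_iff (hc 1) (hc 3)).2 ⟨?_, ?_⟩⟩ <;>
    · rw [← MvPolynomial.coe_inj, coe_polyPullback, coe_polyTerms, coe_polyTerms,
        formalTerms_eq_pullback]
      rfl
  · rintro φ ⟨hc, hker⟩
    obtain ⟨h0, h2⟩ := (deltaBarM_N22_eq_zero_iff (hc 1) (hc 3)).1 hker
    obtain ⟨F, hF⟩ := exists_toSeries_eq_familiesOf (φ 1)
    obtain ⟨G, hG⟩ := exists_toSeries_eq_familiesOf (φ 3)
    refine ⟨(F, G), ?_⟩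
    funext i
    rw [← MvPolynomial.coe_inj, coe_polyTerms, hF, hG]
    exact congrFun (formalTerms_familiesOf (g := fun i => (φ i : MvPowerSeries (Fin 4) ℝ))
      (by rw [constantCoeff_coe, hc]) (by rw [constantCoeff_coe, hc])
      (by rw [h0, coe_polyPullback]) (by rw [h2, coe_polyPullback])) i

end ExplicitForm

end PowerSeriesMaps

/-! ### Weights and dimensions -/

section Dimensions

lemma finrank_submodulePi {ι V : Type*} [Fintype ι] [AddCommGroup V] [Module ℝ V]
    (W : Submodule ℝ V) [Module.Finite ℝ W] :
    Module.finrank ℝ (Submodule.pi Set.univ fun _ : ι => W) =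
      Fintype.card ι * Module.finrank ℝ W := by
  let e : (Submodule.pi Set.univ fun _ : ι => W) ≃ₗ[ℝ] (ι → W) :=
    { toFun := fun φ i => ⟨φ.1 i, φ.2 i (Set.mem_univ i)⟩
      invFun := fun ψ => ⟨fun i => ψ i, fun i _ => (ψ i).2⟩
      map_add' := fun _ _ => rfl
      map_smul' := fun _ _ => rfl
      left_inv := fun _ => rfl
      right_inv := fun _ => rfl }
  rw [e.finrank_eq, Module.finrank_pi_fintype, Finset.sum_const, Finset.card_univ, smul_eq_mul]

lemma finite_restrictSupport {T : Set (Fin 4 →₀ ℕ)} (hT : T.Finite) :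
    Module.Finite ℝ (MvPolynomial.restrictSupport ℝ T) :=
  have := hT.to_subtype
  Module.Finite.of_basis (MvPolynomial.basisRestrictSupport ℝ T)

lemma finrank_restrictSupport (T : Set (Fin 4 →₀ ℕ)) :
    Module.finrank ℝ (MvPolynomial.restrictSupport ℝ T) = T.ncard :=
  Module.finrank_eq_nat_card_basis (MvPolynomial.basisRestrictSupport ℝ T)

/-- The exponents of the monomials of degree `d` in four variables. -/
def exponents (d : ℕ) : Set (Fin 4 →₀ ℕ) := {k | k.degree = d}

lemma finite_exponents (d : ℕ) : (exponents d).Finite := Finsupp.finite_of_degree_eq d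

lemma ncard_exponents (d : ℕ) : (exponents d).ncard = (d + 3).choose 3 := by
  have : exponents d = (Finset.finsuppAntidiag Finset.univ d : Finset (Fin 4 →₀ ℕ)) := by
    ext k
    simp [exponents, Finsupp.degree_eq_sum]
  rw [this, Set.ncard_coe_finset, Finset.card_finsuppAntidiag_nat_eq_choose, Finset.card_univ,
    Fintype.card_fin, show 4 + d - 1 = d + 3 by omega]
  exact Nat.choose_symm_of_eq_add (by omega)

lemma homogeneousSubmodule_eq_restrictSupport (d : ℕ) :
    MvPolynomial.homogeneousSubmodule (Fin 4) ℝ d = MvPolynomial.restrictSupport ℝ (exponents d) :=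
  MvPolynomial.homogeneousSubmodule_eq_finsupp_supported _ _ d

lemma finrank_homogeneousMaps (d : ℕ) :
    Module.finrank ℝ (homogeneousMaps 4 d) = 4 * (d + 3).choose 3 := by
  have := finite_restrictSupport (finite_exponents d)
  rw [homogeneousMaps, homogeneousSubmodule_eq_restrictSupport, finrank_submodulePi,
    finrank_restrictSupport, ncard_exponents, Fintype.card_fin]

/-- The maps whose second components in the two blocks are given, and that lie in the kernel
of `Δ_M̄` if these have no constant term. -/
noncomputable def blockMap : (Fin 2 → MvPolynomial (Fin 4) ℝ) →ₗ[ℝ] PolyMap 4 :=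
  LinearMap.pi ![(polyPullback M22).toLinearMap ∘ₗ LinearMap.proj 0, LinearMap.proj 0,
    (polyPullback M22).toLinearMap ∘ₗ LinearMap.proj 1, LinearMap.proj 1]

lemma blockMap_apply (p : Fin 2 → MvPolynomial (Fin 4) ℝ) :
    blockMap p = ![polyPullback M22 (p 0), p 0, polyPullback M22 (p 1), p 1] := by
  funext i
  fin_cases i <;> rfl

lemma mem_map_blockMap {W : Submodule ℝ (MvPolynomial (Fin 4) ℝ)} {φ : PolyMap 4} :
    φ ∈ (Submodule.pi Set.univ fun _ : Fin 2 => W).map blockMap ↔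
      φ 1 ∈ W ∧ φ 3 ∈ W ∧ φ 0 = polyPullback M22 (φ 1) ∧ φ 2 = polyPullback M22 (φ 3) := by
  constructor
  · rintro ⟨p, hp, rfl⟩
    rw [blockMap_apply]
    exact ⟨hp 0 trivial, hp 1 trivial, rfl, rfl⟩
  · rintro ⟨h1, h3, h0, h2⟩
    refine ⟨![φ 1, φ 3], ?_, ?_⟩
    · intro i _
      fin_cases i
      exacts [h1, h3]
    · rw [blockMap_apply]
      funext i
      fin_cases i
      exacts [h0.symm, rfl, h2.symm, rfl]

lemma finrank_map_blockMap {T : Set (Fin 4 →₀ ℕ)} (hT : T.Finite) :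
    Module.finrank ℝ ((Submodule.pi Set.univ fun _ : Fin 2 =>
      MvPolynomial.restrictSupport ℝ T).map blockMap) = 2 * T.ncard := by
  have hinj : Function.Injective blockMap := fun p q h => by
    simp only [blockMap_apply] at h
    funext i
    fin_cases i
    exacts [congrFun h 1, congrFun h 3]
  have := finite_restrictSupport hT
  rw [← (Submodule.equivMapOfInjective blockMap hinj _).finrank_eq, finrank_submodulePi,
    finrank_restrictSupport, Fintype.card_fin]

/-- In positive degree, the kernel of `Δ_M̄` is parametrized by the second components. -/
lemma kernel_eq_map_blockMap {d : ℕ} (hd : d ≠ 0) :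
    homogeneousMaps 4 d ⊓ LinearMap.ker (deltaBarM N22) =
      (Submodule.pi Set.univ fun _ : Fin 2 =>
        MvPolynomial.restrictSupport ℝ (exponents d)).map blockMap := by
  have hc : ∀ {p : MvPolynomial (Fin 4) ℝ}, p.IsHomogeneous d →
      MvPolynomial.constantCoeff p = 0 := fun hp => by
    rw [MvPolynomial.constantCoeff_eq]
    exact hp.coeff_eq_zero (by simpa using hd.symm)
  ext φ
  rw [mem_map_blockMap, ← homogeneousSubmodule_eq_restrictSupport, Submodule.mem_inf,
    LinearMap.mem_ker, MvPolynomial.mem_homogeneousSubmodule, MvPolynomial.mem_homogeneousSubmodule]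
  have hmem : φ ∈ homogeneousMaps 4 d ↔ ∀ i, (φ i).IsHomogeneous d := by
    simp [homogeneousMaps, Submodule.mem_pi, MvPolynomial.mem_homogeneousSubmodule]
  rw [hmem]
  constructor
  · rintro ⟨h, hker⟩
    exact ⟨h 1, h 3, (deltaBarM_N22_eq_zero_iff (hc (h 1)) (hc (h 3))).1 hker⟩
  · rintro ⟨h1, h3, h02⟩
    refine ⟨fun i => ?_, (deltaBarM_N22_eq_zero_iff (hc h1) (hc h3)).2 h02⟩
    fin_cases i
    · exact (congrArg (MvPolynomial.IsHomogeneous · d) h02.1).mpr (isHomogeneous_polyPullback _ h1)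
    · exact h1
    · exact (congrArg (MvPolynomial.IsHomogeneous · d) h02.2).mpr (isHomogeneous_polyPullback _ h3)
    · exact h3

lemma finrank_kernel {d : ℕ} (hd : d ≠ 0) :
    Module.finrank ℝ ↥(homogeneousMaps 4 d ⊓ LinearMap.ker (deltaBarM N22)) =
      2 * (d + 3).choose 3 := by
  rw [kernel_eq_map_blockMap hd, finrank_map_blockMap (finite_exponents d), ncard_exponents]

/-- Diagonal substitutions scale monomials. -/
lemma coeff_polyPullback_diagonal {n : ℕ} (w : Fin n → ℝ) (p : MvPolynomial (Fin n) ℝ)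
    (k : Fin n →₀ ℕ) : MvPolynomial.coeff k (polyPullback (Matrix.diagonal w) p) =
      (∏ j, w j ^ k j) * MvPolynomial.coeff k p := by
  classical
  have hlin : ∀ j, ∑ l, Matrix.diagonal w j l • (MvPolynomial.X l : MvPolynomial (Fin n) ℝ) =
      MvPolynomial.C (w j) * MvPolynomial.X j := fun j => by
    rw [Finset.sum_eq_single j (fun l _ hl => by
      rw [Matrix.diagonal_apply_ne _ hl.symm, zero_smul]) (by simp), Matrix.diagonal_apply_eq,
      MvPolynomial.smul_eq_C_mul]
  induction p using MvPolynomial.induction_on' with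
  | monomial d c =>
    have : polyPullback (Matrix.diagonal w) (MvPolynomial.monomial d c) =
        MvPolynomial.monomial d ((∏ j, w j ^ d j) * c) := by
      rw [polyPullback, MvPolynomial.aeval_monomial, Finsupp.prod_fintype _ _ (by simp)]
      simp only [hlin, mul_pow, Finset.prod_mul_distrib]
      rw [MvPolynomial.monomial_eq, Finsupp.prod_fintype _ _ (by simp), map_mul, map_prod,
        MvPolynomial.algebraMap_eq]
      simp only [map_pow]
      ring
    rw [this, MvPolynomial.coeff_monomial, MvPolynomial.coeff_monomial]
    split_ifs with h
    · rw [h]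
    · rw [mul_zero]
  | add p q hp hq => rw [map_add, MvPolynomial.coeff_add, MvPolynomial.coeff_add, hp, hq, mul_add]

lemma N22_mul_M22 : N22 * M22 = Matrix.diagonal ![1, 0, 1, 0] := by
  ext i j
  fin_cases i <;> fin_cases j <;> simp [N22, Matrix.mul_apply, Fin.sum_univ_four]

lemma M22_mul_N22 : M22 * N22 = Matrix.diagonal ![0, 1, 0, 1] := by
  ext i j
  fin_cases i <;> fin_cases j <;> simp [N22, Matrix.mul_apply, Fin.sum_univ_four]

lemma sumBarH_N22_apply (φ : PolyMap 4) (i : Fin 4) :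
    sumBarH N22 φ i = (![-1, 1, -1, 1] i : ℝ) • φ i +
      (polyPullback (N22 * M22) (φ i) - polyPullback (M22 * N22) (φ i)) := by
  have hsub : ∀ A B : Matrix (Fin 4) (Fin 4) ℝ, (substOp A * substOp B) φ i =
      polyPullback (B * A) (φ i) := fun A B => by
    rw [Module.End.mul_apply, substOp_apply, substOp_apply, polyPullback_polyPullback]
  have hmul : M22 * N22 - N22 * M22 = Matrix.diagonal ![-1, 1, -1, 1] := by
    rw [M22_mul_N22, N22_mul_M22, Matrix.diagonal_sub]
    congr 1
    funext i
    fin_cases i <;> simp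
  simp only [sumBarH, barH, nilpotencyClass_N22, Nat.add_one_sub_one, Finset.Icc_self,
    Finset.sum_singleton, pow_one, LinearMap.add_apply, LinearMap.sub_apply, Pi.add_apply,
    Pi.sub_apply, hsub, multOp_apply]
  rw [hmul, Finset.sum_eq_single i (fun l _ hl => by
    rw [Matrix.diagonal_apply_ne _ hl.symm, zero_smul]) (by simp), Matrix.diagonal_apply_eq]

/-- The eigenvalue of `H̄_* + \overline{H^*}` on the element of the kernel whose second component
is the monomial with exponent `k`. -/
noncomputable def weight (k : Fin 4 →₀ ℕ) : ℝ :=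
  1 + ((if k 1 = 0 ∧ k 3 = 0 then 1 else 0) - if k 0 = 0 ∧ k 2 = 0 then 1 else 0)

/-- The exponents of degree `d` and weight `w`. -/
noncomputable def weightExponents (d : ℕ) (w : ℝ) : Set (Fin 4 →₀ ℕ) :=
  {k | k ∈ exponents d ∧ weight k = w}

/-- The operator `H̄_* + \overline{H^*}` is diagonal in the monomials of a second component. -/
lemma coeff_weightOp (p : MvPolynomial (Fin 4) ℝ) (k : Fin 4 →₀ ℕ) :
    MvPolynomial.coeff k (p + (polyPullback (N22 * M22) p - polyPullback (M22 * N22) p)) =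
      weight k * MvPolynomial.coeff k p := by
  rw [N22_mul_M22, M22_mul_N22, MvPolynomial.coeff_add, MvPolynomial.coeff_sub,
    coeff_polyPullback_diagonal, coeff_polyPullback_diagonal, weight, ← sub_mul, ← one_add_mul]
  congr 3
  · simp [Fin.prod_univ_four, zero_pow_eq, ← ite_and, and_comm]
  · simp [Fin.prod_univ_four, zero_pow_eq, ← ite_and, and_comm]

/-- On the kernel of `Δ_M̄`, the eigenvalue equation in the first components follows from the one in
the second components. -/
lemma kernel_inf_eigenspace_eq {d : ℕ} (hd : d ≠ 0) (w : ℝ) :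
    homogeneousMaps 4 d ⊓ LinearMap.ker (deltaBarM N22) ⊓
        Module.End.eigenspace (sumBarH N22) w =
      (Submodule.pi Set.univ fun _ : Fin 2 =>
        MvPolynomial.restrictSupport ℝ (weightExponents d w)).map blockMap := by
  have hmem : ∀ p : MvPolynomial (Fin 4) ℝ,
      p ∈ MvPolynomial.restrictSupport ℝ (weightExponents d w) ↔
        p ∈ MvPolynomial.restrictSupport ℝ (exponents d) ∧
        p + (polyPullback (N22 * M22) p - polyPullback (M22 * N22) p) = w • p := by
    intro p
    rw [MvPolynomial.mem_restrictSupport_iff, MvPolynomial.mem_restrictSupport_iff]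
    have : weightExponents d w = exponents d ∩ {k | weight k = w} := rfl
    rw [this, Set.subset_inter_iff]
    refine and_congr_right fun _ => ?_
    rw [MvPolynomial.ext_iff]
    refine forall_congr' fun k => ?_
    rw [coeff_weightOp, MvPolynomial.coeff_smul, smul_eq_mul, mul_eq_mul_right_iff, SetLike.mem_coe,
      MvPolynomial.mem_support_iff, Set.mem_ofPred_eq]
    tauto
  ext φ
  rw [Submodule.mem_inf, kernel_eq_map_blockMap hd, mem_map_blockMap, mem_map_blockMap,
    Module.End.mem_eigenspace_iff, hmem, hmem]
  have hev : sumBarH N22 φ = w • φ ↔ ∀ i, (![-1, 1, -1, 1] i : ℝ) • φ i +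
      (polyPullback (N22 * M22) (φ i) - polyPullback (M22 * N22) (φ i)) = w • φ i := by
    rw [funext_iff]
    exact forall_congr' fun i => by rw [sumBarH_N22_apply, Pi.smul_apply]
  rw [hev]
  constructor
  · rintro ⟨⟨h1, h3, h0, h2⟩, h⟩
    refine ⟨⟨h1, ?_⟩, ⟨h3, ?_⟩, h0, h2⟩
    · simpa using h 1
    · simpa using h 3
  · rintro ⟨⟨h1, e1⟩, ⟨h3, e3⟩, h0, h2⟩
    refine ⟨⟨h1, h3, h0, h2⟩, ?_⟩
    have hMNM : M22 * (N22 * M22) = M22 := by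
      have := congrArg Matrix.transpose N22_mul_M22_mul_N22
      simpa [M22, Matrix.transpose_mul, mul_assoc] using this
    have upper : ∀ p : MvPolynomial (Fin 4) ℝ, p ∈ MvPolynomial.restrictSupport ℝ (exponents d) →
        p + (polyPullback (N22 * M22) p - polyPullback (M22 * N22) p) = w • p →
        -polyPullback M22 p + (polyPullback (N22 * M22) (polyPullback M22 p) -
          polyPullback (M22 * N22) (polyPullback M22 p)) = w • polyPullback M22 p := by
      intro p hp h
      have hc : MvPolynomial.constantCoeff p = 0 := by
        rw [← homogeneousSubmodule_eq_restrictSupport, MvPolynomial.mem_homogeneousSubmodule] at hp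
        rw [MvPolynomial.constantCoeff_eq]
        exact hp.coeff_eq_zero (by simpa using hd.symm)
      have h2 := congrArg (polyPullback M22) h
      simp only [map_add, map_sub, map_smul, polyPullback_polyPullback, mul_assoc, M22_mul_M22,
        hMNM, mul_zero, polyPullback_zero_matrix, hc, map_zero] at h2
      rw [← h2, polyPullback_polyPullback, polyPullback_polyPullback, hMNM, ← mul_assoc,
        M22_mul_M22, zero_mul, polyPullback_zero_matrix, hc, map_zero]
      abel
    intro i
    fin_cases i
    · simpa [h0] using upper _ h1 e1
    · simpa using e1
    · simpa [h2] using upper _ h3 e3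
    · simpa using e3

lemma finrank_kernel_inf_eigenspace {d : ℕ} (hd : d ≠ 0) (w : ℝ) :
    Module.finrank ℝ ↥(homogeneousMaps 4 d ⊓ LinearMap.ker (deltaBarM N22) ⊓
      Module.End.eigenspace (sumBarH N22) w) = 2 * (weightExponents d w).ncard := by
  rw [kernel_inf_eigenspace_eq hd,
    finrank_map_blockMap ((finite_exponents d).subset fun _ h => h.1)]

lemma ncard_exponents_two_variables {d : ℕ} (i j i' j' : Fin 4) (hij : i ≠ j)
    (hu : ∀ l, l = i ∨ l = j ∨ l = i' ∨ l = j') (hn : i ≠ i' ∧ i ≠ j' ∧ j ≠ i' ∧ j ≠ j') :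
    {k ∈ exponents d | k i' = 0 ∧ k j' = 0}.ncard = d + 1 := by
  have himg : {k ∈ exponents d | k i' = 0 ∧ k j' = 0} =
      (fun a => Finsupp.single i a + Finsupp.single j (d - a)) '' (Finset.range (d + 1)) := by
    ext k
    constructor
    · rintro ⟨hk, h1, h2⟩
      have hk' : k = Finsupp.single i (k i) + Finsupp.single j (k j) := by
        ext l
        rcases hu l with rfl | rfl | rfl | rfl <;>
          simp [hij, hij.symm, h1, h2, hn.1, hn.2.1, hn.2.2.1, hn.2.2.2]
      have hdeg : k i + k j = d := by
        have := congrArg Finsupp.degree hk'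
        rw [map_add, Finsupp.degree_single, Finsupp.degree_single] at this
        rw [← this]
        exact hk
      refine ⟨k i, by simpa using by omega, ?_⟩
      have hj : d - k i = k j := by omega
      simpa only [hj] using hk'.symm
    · rintro ⟨a, ha, rfl⟩
      have ha' : a < d + 1 := by simpa using ha
      refine ⟨?_, ?_, ?_⟩
      · change Finsupp.degree _ = d
        rw [map_add, Finsupp.degree_single, Finsupp.degree_single]
        omega
      · simp [hn.1, hn.2.2.1]
      · simp [hn.2.1, hn.2.2.2]
  rw [himg, Set.ncard_image_of_injective, Set.ncard_coe_finset, Finset.card_range]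
  intro a b hab
  have := DFunLike.congr_fun hab i
  simpa [hij, hij.symm] using this

/-- Weight two means that only `x₁` and `x₃` occur; the assumption `d ≠ 0` excludes the monomial
`1`, which has weight one. -/
lemma ncard_weightExponents_two {d : ℕ} (hd : d ≠ 0) : (weightExponents d 2).ncard = d + 1 := by
  rw [← ncard_exponents_two_variables (d := d) 0 2 1 3 (by decide) (by decide) (by decide)]
  congr 1
  ext k
  refine and_congr_right fun hk => ?_
  have h0 : k 0 + k 1 + k 2 + k 3 = d := by
    rw [← (show k.degree = d from hk), Finsupp.degree_eq_sum, Fin.sum_univ_four]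
  rw [weight]
  split_ifs with h1 h2 h2
  · omega
  · norm_num [h1]
  · norm_num [h1]
  · norm_num [h1]

lemma ncard_weightExponents_zero {d : ℕ} (hd : d ≠ 0) : (weightExponents d 0).ncard = d + 1 := by
  rw [← ncard_exponents_two_variables (d := d) 1 3 0 2 (by decide) (by decide) (by decide)]
  congr 1
  ext k
  refine and_congr_right fun hk => ?_
  have h0 : k 0 + k 1 + k 2 + k 3 = d := by
    rw [← (show k.degree = d from hk), Finsupp.degree_eq_sum, Fin.sum_univ_four]
  rw [weight]
  split_ifs with h1 h2 h2
  · omega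
  · norm_num [h2]
  · norm_num [h2]
  · norm_num [h2]

lemma weight_eq_zero_or_one_or_two (k : Fin 4 →₀ ℕ) :
    weight k = 0 ∨ weight k = 1 ∨ weight k = 2 := by
  rw [weight]
  split_ifs <;> norm_num

lemma ncard_weightExponents_one {d : ℕ} (hd : d ≠ 0) :
    (weightExponents d 1).ncard + 2 * (d + 1) = (d + 3).choose 3 := by
  have hunion : exponents d =
      weightExponents d 0 ∪ (weightExponents d 1 ∪ weightExponents d 2) := by
    ext k
    constructor
    · intro hk
      exact (weight_eq_zero_or_one_or_two k).imp (⟨hk, ·⟩) (Or.imp (⟨hk, ·⟩) (⟨hk, ·⟩))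
    · rintro (h | h | h) <;> exact h.1
  have hfin : ∀ w, (weightExponents d w).Finite := fun w =>
    (finite_exponents d).subset fun _ h => h.1
  have hdisj : ∀ {v w : ℝ}, v ≠ w → Disjoint (weightExponents d v) (weightExponents d w) :=
    fun hvw => Set.disjoint_left.2 fun k hv hw => hvw (hv.2.symm.trans hw.2)
  rw [← ncard_exponents, hunion, Set.ncard_union_eq (Set.disjoint_union_right.2
    ⟨hdisj (by norm_num), hdisj (by norm_num)⟩) (hfin 0) ((hfin 1).union (hfin 2)),
    Set.ncard_union_eq (hdisj (by norm_num)) (hfin 1) (hfin 2), ncard_weightExponents_zero hd,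
    ncard_weightExponents_two hd]
  omega

end Dimensions

/-! ### Generating functions -/

section GeneratingFunctions

open PowerSeries

lemma coeff_geom_succ (R : Type) [CommRing R] (k d : ℕ) :
    coeff d (geom R (k + 1)) = ((k + d).choose k : R) := by
  rw [geom, invOneSubPow_val_succ_eq_mk_add_choose, coeff_mk]

lemma coeff_zero_G22 : coeff 0 G22 = 2 * Polynomial.X := by
  rw [G22, map_add, weightedKernelSeries, coeff_mk, if_pos rfl, add_zero, uVar,
    ← map_ofNat (C (R := Polynomial ℤ)) 2, ← map_mul, coeff_zero_C]

lemma coeff_weightedKernelSeries {d : ℕ} (hd : d ≠ 0) :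
    coeff d (weightedKernelSeries N22) = 2 * ((d + 1 : ℕ) : Polynomial ℤ) * (Polynomial.X ^ 2 + 1) +
      2 * ((weightExponents d 1).ncard : Polynomial ℤ) * Polynomial.X := by
  have hmon : ∀ (w n : ℕ), Polynomial.monomial w ((2 * n : ℕ) : ℤ) =
      2 * (n : Polynomial ℤ) * Polynomial.X ^ w := fun w n => by
    rw [← Polynomial.C_mul_X_pow_eq_monomial]
    push_cast
    simp
  rw [weightedKernelSeries, coeff_mk, if_neg hd, finsum_eq_sum_of_support_subset (s := {0, 1, 2})]
  · rw [Finset.sum_insert (by simp), Finset.sum_insert (by simp), Finset.sum_singleton]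
    simp only [finrank_kernel_inf_eigenspace hd, hmon]
    rw [Nat.cast_zero, Nat.cast_one, Nat.cast_ofNat, ncard_weightExponents_zero hd,
      ncard_weightExponents_two hd]
    ring
  · intro w hw
    rw [Function.mem_support, finrank_kernel_inf_eigenspace hd] at hw
    have hne : weightExponents d w ≠ ∅ := fun h => hw (by rw [h]; simp)
    obtain ⟨k, -, hk⟩ := Set.nonempty_iff_ne_empty.2 hne
    rw [Finset.coe_insert, Finset.coe_insert, Finset.coe_singleton]
    rcases weight_eq_zero_or_one_or_two k with h | h | h <;> rw [h] at hk
    · left; exact_mod_cast hk.symm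
    · right; left; exact_mod_cast hk.symm
    · right; right; exact_mod_cast hk.symm

lemma coeff_G22 {d : ℕ} (hd : d ≠ 0) :
    coeff d G22 = 2 * ((d + 1 : ℕ) : Polynomial ℤ) * (Polynomial.X ^ 2 + 1) +
      2 * ((weightExponents d 1).ncard : Polynomial ℤ) * Polynomial.X := by
  rw [G22, map_add, coeff_weightedKernelSeries hd, uVar, ← map_ofNat (C (R := Polynomial ℤ)) 2,
    ← map_mul, coeff_C, if_neg hd, zero_add]

/-- The number of exponents of weight one, in the form in which it appears as a coefficient of
`t² / (1 - t)⁴ + 2 t² / (1 - t)³ + t² / (1 - t)²`. -/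
lemma ncard_weightExponents_one_add_two (d : ℕ) : (weightExponents (d + 2) 1).ncard =
    (3 + d).choose 3 + 2 * (2 + d).choose 2 + (1 + d).choose 1 := by
  have h := ncard_weightExponents_one (d := d + 2) (by omega)
  have h2 : (d + 2 + 3).choose 3 = (3 + d).choose 3 + 2 * (2 + d).choose 2 + (1 + d).choose 1 +
      2 * (d + 2 + 1) := by
    rw [add_comm 3, add_comm 2 d, add_comm 1]
    simp only [Nat.choose_succ_succ', Nat.choose_zero_right]
    rw [show d.choose 1 = d from Nat.choose_one_right d]
    ring
  omega

theorem G22_eq : G22 = 2 * uVar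
      + 2 * uVar * tVar ^ 2 * geom (Polynomial ℤ) 4
      + 2 * (2 * uVar * tVar ^ 2 * geom (Polynomial ℤ) 3)
      + 2 * uVar * tVar ^ 2 * geom (Polynomial ℤ) 2
      + 2 * ((uVar ^ 2 + 1) * tVar * geom (Polynomial ℤ) 2)
      + 2 * ((uVar ^ 2 + 1) * tVar * geom (Polynomial ℤ) 1) := by
  have hform : 2 * uVar
      + 2 * uVar * tVar ^ 2 * geom (Polynomial ℤ) 4
      + 2 * (2 * uVar * tVar ^ 2 * geom (Polynomial ℤ) 3)
      + 2 * uVar * tVar ^ 2 * geom (Polynomial ℤ) 2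
      + 2 * ((uVar ^ 2 + 1) * tVar * geom (Polynomial ℤ) 2)
      + 2 * ((uVar ^ 2 + 1) * tVar * geom (Polynomial ℤ) 1) =
      C (2 * Polynomial.X) + C (2 * Polynomial.X) * (X ^ 2 * (geom (Polynomial ℤ) 4 +
        (2 : ℕ) • geom (Polynomial ℤ) 3 + geom (Polynomial ℤ) 2)) +
      C (2 * (Polynomial.X ^ 2 + 1)) * (X ^ 1 * (geom (Polynomial ℤ) 2 +
        geom (Polynomial ℤ) 1)) := by
    simp only [uVar, tVar, map_mul, map_add, map_pow, map_one, map_ofNat, nsmul_eq_mul,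
      Nat.cast_ofNat]
    ring
  rw [hform]
  ext1 d
  rw [map_add, map_add, coeff_C_mul, coeff_C_mul, coeff_C, coeff_X_pow_mul', coeff_X_pow_mul']
  simp only [map_add, map_nsmul, coeff_geom_succ]
  obtain rfl | rfl | ⟨d, rfl⟩ : d = 0 ∨ d = 1 ∨ ∃ e, d = e + 2 := by
    rcases d with _ | _ | d
    exacts [Or.inl rfl, Or.inr (Or.inl rfl), Or.inr (Or.inr ⟨d, rfl⟩)]
  · simp [coeff_zero_G22]
  · have h1 : (weightExponents 1 1).ncard = 0 := by
      have := ncard_weightExponents_one (d := 1) one_ne_zero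
      simpa [Nat.choose] using this
    rw [coeff_G22 one_ne_zero, h1]
    simp
    ring
  · rw [coeff_G22 (by omega), ncard_weightExponents_one_add_two]
    simp
    ring

theorem cushmanSanders_G22 : cushmanSanders G22 = 4 * geom ℤ 4 := by
  ext d
  rw [cushmanSanders, coeff_mk, ← map_ofNat (C (R := ℤ)) 4, coeff_C_mul, coeff_geom_succ]
  rcases Nat.eq_zero_or_pos d with rfl | hd
  · rw [coeff_zero_G22]
    simp
  · rw [coeff_G22 hd.ne', add_comm 3 d, ← ncard_weightExponents_one hd.ne']
    simp
    ring

theorem allMapsSeries_four : allMapsSeries 4 = 4 * geom ℤ 4 := by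
  ext d
  rw [allMapsSeries, coeff_mk, ← map_ofNat (C (R := ℤ)) 4, coeff_C_mul, coeff_geom_succ,
    finrank_homogeneousMaps, add_comm 3 d]
  push_cast
  rfl

lemma coeff_atOne_G22 (d : ℕ) : coeff d (atOne G22) = 2 * ((d + 3).choose 3 : ℤ) := by
  rw [atOne, coeff_map]
  rcases Nat.eq_zero_or_pos d with rfl | hd
  · rw [coeff_zero_G22]
    simp
  · rw [coeff_G22 hd.ne', ← ncard_weightExponents_one hd.ne']
    simp
    ring

theorem atOne_G22_eq_add : atOne G22 = 2 + kernelSeries N22 := by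
  ext d
  rw [coeff_atOne_G22, map_add, ← map_ofNat (C (R := ℤ)) 2, coeff_C, kernelSeries, coeff_mk]
  split_ifs with hd
  · simp [hd]
  · rw [finrank_kernel hd]
    push_cast
    ring

theorem atOne_G22_eq : atOne G22 = 2 * geom ℤ 4 := by
  ext d
  rw [coeff_atOne_G22, ← map_ofNat (C (R := ℤ)) 2, coeff_C_mul, coeff_geom_succ, add_comm 3 d]

end GeneratingFunctions

end NilpotentMaps

theorem mainTheorem6 :
    -- the kernel of `Δ_{M̄}` is a normal form style
    IsStyle N22 (kerStyle N22) ∧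
    -- explicit description of the kernel, without redundancy
    Function.Injective polyTerms ∧
    Set.range polyTerms =
      {φ : PolyMap 4 | (∀ i, MvPolynomial.constantCoeff (φ i) = 0) ∧ deltaBarM N22 φ = 0} ∧
    -- the maps in normal form are exactly those of the explicit form, in a unique way
    (∀ f : FormalMap 4, IsInNormalForm N22 (kerStyle N22) f ↔
      ∃! FG : Families Series × Families Series,
        FG.1.NoLinearTerms ∧ FG.2.NoLinearTerms ∧ f = linearMap N22 + formalTerms FG) ∧
    -- every map with linear part `N22` can be brought into normal form
    (∀ f : FormalMap 4, FixesZero f → jacobianAtZero f = N22 →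
      ∃ φ ψ : FormalMap 4, NearIdentity φ ∧ NearIdentity ψ ∧
        comp φ ψ = idMap 4 ∧ comp ψ φ = idMap 4 ∧
        IsInNormalForm N22 (kerStyle N22) (comp φ (comp f ψ))) ∧
    -- the generating function `G(u, t)`, the Cushman-Sanders test, and `G(1, t)`
    G22 = 2 * uVar
      + 2 * uVar * tVar ^ 2 * geom (Polynomial ℤ) 4
      + 2 * (2 * uVar * tVar ^ 2 * geom (Polynomial ℤ) 3)
      + 2 * uVar * tVar ^ 2 * geom (Polynomial ℤ) 2
      + 2 * ((uVar ^ 2 + 1) * tVar * geom (Polynomial ℤ) 2)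
      + 2 * ((uVar ^ 2 + 1) * tVar * geom (Polynomial ℤ) 1) ∧
    cushmanSanders G22 = 4 * geom ℤ 4 ∧
    allMapsSeries 4 = 4 * geom ℤ 4 ∧
    atOne G22 = 2 + kernelSeries N22 ∧
    atOne G22 = 2 * geom ℤ 4 := by
  exact ⟨isStyle_kerStyle_N22, polyTerms_injective, range_polyTerms,
    isInNormalForm_iff_existsUnique, fun _ h0 h1 => exists_conjugate_isInNormalForm h0 h1, G22_eq,
    cushmanSanders_G22, allMapsSeries_four, atOne_G22_eq_add, atOne_G22_eq⟩
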